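/- **Notation.** An admissible weight is a measurable $v:\mathbb{R}\to[1,\infty)$ with $\sup_{s,t}\frac{v(s+t)}{v(s)+v(t)}<\infty$. For $\omega>0$ let $S_\omega=\{z\in\mathbb{C}: |\operatorname{Im}z|<\omega\}$, and $S_0=\mathbb{R}$. Write $\hat g(z)=\int_{\mathbb{R}} g(s)e^{-isz}\,ds$, and let $F^\vee$ be the inverse Fourier transform, $F^\vee(s)=\frac1{2\pi}\int_{\mathbb R} F(x)e^{isx}\,dx$ (in the sense of Plancherel for $F\in L^2(\mathbb{R})$). Let $L^2_{v,\omega}=\{g\in L^2(\mathbb{R}): v e^{\omega|\cdot|}g\in L^2(\mathbb{R})\}$ and $W^2_v(S_\omega)=\{\hat g: g\in L^2_{v,\omega}\}$ with norm $\|\hat g\|_{W^2_v(S_\omega)}=\|v e^{\omega|\cdot|}g\|_{L^2(\mathbb R)}$; for $\omega>0$ its elements are holomorphic functions on $S_\omega$, for $\omega=0$ they are elements of $L^2(\mathbb{R})$. For $\sigma>0$, $H^\infty_0(S_\sigma)$ is the space of holomorphic $f$ on $S_\sigma$ such that for every $\alpha>0$ one has $|f(z)|\le C_\alpha(1+|\operatorname{Re}z|)^{-\alpha}$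 on $S_\sigma$; for $\omega\ge0$, $H^\infty_0[\overline{S}_\omega]=\bigcup_{\sigma>\omega}H^\infty_0(S_\sigma)$. Put $\tau_zf=f(\cdot-z)$. For $0\ne\psi\in H^\infty_0[\overline S_\omega]$, $\text{Hör}^2_v(S_\omega;\psi)$ is the space of functions $f$ on $S_\omega$ (modulo null sets if $\omega=0$) such that $\tau_t\psi\cdot f\in W^2_v(S_\omega)$ for all $t\in\mathbb{R}$ and $\|f\|_{\text{Hör}^2_v(S_\omega;\psi)}:=\sup_{t\in\mathbb{R}}\|\tau_t\psi\cdot f\|_{W^2_v(S_\omega)}<\infty$. **Theorem.** Let $v$ be an admissible weight, $\omega\ge0$, $0\ne\psi\in H^\infty_0[\overline S_\omega]$, $\theta>0$ and $\varphi\in H^\infty_0(S_{\theta+\omega})$. Below, $\theta'$ denotes any number with $0<\theta'\le\theta$ and $\varphi\in H^\infty_0[\overline S_{\theta'+\omega}]$; every $\theta'\in(0,\theta)$ qualifies, and $\theta'=\theta$ qualifies if $\varphi\in H^\infty_0[\overline S_{\theta+\omega}]$. a) For each $f\in\text{Hör}^2_v(S_\omega;\psi)$ one has $\tau_z\varphi\cdot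 f\in W^2_v(S_\omega)$ for all $z\in S_\theta$, and $z\mapsto\tau_z\varphi\cdot f$ is a holomorphic map $S_\theta\to W^2_v(S_\omega)$. For each $\theta'$ as above there is a constant $C$ with $$\sup_{z\in S_{\theta'}}\|\tau_z\varphi\cdot f\|_{W^2_v(S_\omega)}\le C\,\|f\|_{\text{Hör}^2_v(S_\omega;\psi)}\qquad\text{for all } f\in\text{Hör}^2_v(S_\omega;\psi).$$ In particular, if $\varphi\in H^\infty_0[\overline S_{\theta+\omega}]$, the map is bounded and holomorphic on all of $S_\theta$. b) For each $f\in\text{Hör}^2_v(S_\omega;\psi)$ and $z\in S_\theta$, $(\tau_z\varphi\cdot f)^\vee$ is (has a representative that is) continuous on $\mathbb{R}$, and for each $\theta'$ as above there is a constant $C$ with $$\sup_{z\in S_{\theta'},\,s\in\mathbb{R}}v(s)e^{\omega|s|}\,|(\tau_z\varphi\cdot f)^\vee(s)|\le C\,\|f\|_{\text{Hör}^2_v(S_\omega;\psi)}\qquad\text{for all } f\in\text{Hör}^2_v(S_\omega;\psi).$$ c) If $\omega>0$, then for each $f\in\text{Hör}^2_v(S_\omega;\psi)$ and $z\in S_\theta\cap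 S_\omega$ the following integral converges absolutely and $$\varphi(0)f(z)=\int_{\mathbb{R}}(\tau_z\varphi\cdot f)^\vee(s)\,e^{-isz}\,ds .$$ d) Consequently the Hörmander space does not depend on the localizing function: for every $0\ne\psi'\in H^\infty_0[\overline S_\omega]$ one has $\text{Hör}^2_v(S_\omega;\psi)=\text{Hör}^2_v(S_\omega;\psi')$ with equivalent norms. -/

import Mathlib

open MeasureTheory
open scoped FourierTransform ENNReal NNReal

noncomputable section

namespace StripHormander

/-- An admissible weight: a measurable `v : ℝ → [1, ∞)` with
`sup_{s,t} v (s + t) / (v s + v t) < ∞`. -/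
structure AdmissibleWeight where
  toFun : ℝ → ℝ
  measurable : Measurable toFun
  one_le : ∀ s, 1 ≤ toFun s
  quasiSubadditive : ∃ M : ℝ, ∀ s t, toFun (s + t) ≤ M * (toFun s + toFun t)

instance : CoeFun AdmissibleWeight (fun _ => ℝ → ℝ) := ⟨AdmissibleWeight.toFun⟩

/-- The horizontal strip: `{z | |Im z| < ω}` for `ω > 0`, and the real line for `ω = 0`. -/
def strip (ω : ℝ) : Set ℂ := {z | |z.im| < ω ∨ (ω = 0 ∧ z.im = 0)}

/-- The holomorphic Schwartz functions on the (open) strip of height `σ > 0`. A function on a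
strip is given by a function on `ℂ` whose values outside the strip play no role. -/
def HolSchwartz (σ : ℝ) : Set (ℂ → ℂ) :=
  {f | DifferentiableOn ℂ f (strip σ) ∧
    ∀ α : ℝ, 0 < α → ∃ C : ℝ, ∀ z ∈ strip σ, ‖f z‖ ≤ C / (1 + |z.re|) ^ α}

/-- The union of the spaces of holomorphic Schwartz functions over all strips of height `σ > ω`. -/
def HolSchwartzClosed (ω : ℝ) : Set (ℂ → ℂ) := {f | ∃ σ, ω < σ ∧ f ∈ HolSchwartz σ}

/-- The inverse Fourier transform of `F ∈ L²(ℝ)` (in the sense of Plancherel), normalised such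
that `F^∨ s = (2π)⁻¹ ∫ F x e^{isx} dx` for integrable `F`. Mathlib's `𝓕⁻` has the kernel
`e^{2πisx}` and no prefactor. -/
def invFourier (F : Lp ℂ 2 (volume : Measure ℝ)) : ℝ → ℂ :=
  fun s => (2 * (Real.pi : ℂ))⁻¹ * (𝓕⁻ F : Lp ℂ 2 (volume : Measure ℝ)) (s / (2 * Real.pi))

/-- The function `v e^{ω|·|} F^∨`. -/
def weighted (v : AdmissibleWeight) (ω : ℝ) (F : Lp ℂ 2 (volume : Measure ℝ)) : ℝ → ℂ :=
  fun s => ((v s * Real.exp (ω * |s|) : ℝ) : ℂ) * invFourier F s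

theorem ae_dilate {p : ℝ → Prop} (h : ∀ᵐ s, p s) : ∀ᵐ s : ℝ, p (s / (2 * Real.pi)) := by
  have hc : (2 * Real.pi)⁻¹ ≠ 0 := by positivity
  have hq : Measure.QuasiMeasurePreserving (fun s : ℝ => s * (2 * Real.pi)⁻¹) volume volume := by
    refine ⟨by fun_prop, ?_⟩
    rw [Real.map_volume_mul_right hc]
    exact Measure.smul_absolutelyContinuous
  simpa [div_eq_mul_inv] using hq.ae h

theorem weighted_add (v : AdmissibleWeight) (ω : ℝ) (F G : Lp ℂ 2 (volume : Measure ℝ)) :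
    weighted v ω (F + G) =ᵐ[volume] weighted v ω F + weighted v ω G := by
  have h := Lp.coeFn_add (𝓕⁻ F : Lp ℂ 2 (volume : Measure ℝ)) (𝓕⁻ G)
  filter_upwards [ae_dilate h] with s hs
  simp only [weighted, invFourier, Pi.add_apply, FourierTransform.fourierInv_add] at hs ⊢
  rw [hs]; ring

theorem weighted_smul (v : AdmissibleWeight) (ω : ℝ) (c : ℂ)
    (F : Lp ℂ 2 (volume : Measure ℝ)) :
    weighted v ω (c • F) =ᵐ[volume] c • weighted v ω F := by
  have h := Lp.coeFn_smul c (𝓕⁻ F : Lp ℂ 2 (volume : Measure ℝ))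
  filter_upwards [ae_dilate h] with s hs
  simp only [weighted, invFourier, Pi.smul_apply, smul_eq_mul,
    FourierTransform.fourierInv_smul] at hs ⊢
  rw [hs]; ring

/-- The Fourier transforms of the functions in the weighted space
`L²_{v,ω} = {g ∈ L²(ℝ) | v e^{ω|·|} g ∈ L²(ℝ)}`, as a linear subspace of `L²(ℝ)`. -/
def sobolevSubmodule (v : AdmissibleWeight) (ω : ℝ) :
    Submodule ℂ (Lp ℂ 2 (volume : Measure ℝ)) where
  carrier := {F | MemLp (weighted v ω F) 2 volume}
  add_mem' {F G} hF hG := (memLp_congr_ae (weighted_add v ω F G)).2 (MemLp.add hF hG)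
  zero_mem' := by
    have h := weighted_smul v ω 0 0
    rw [zero_smul, zero_smul] at h
    exact (memLp_congr_ae h).2 MemLp.zero
  smul_mem' c F hF := (memLp_congr_ae (weighted_smul v ω c F)).2 (MemLp.const_smul hF c)

/-- `F ↦ v e^{ω|·|} F^∨`, as a linear map into `L²(ℝ)`. -/
def weightedMap (v : AdmissibleWeight) (ω : ℝ) :
    sobolevSubmodule v ω →ₗ[ℂ] Lp ℂ 2 (volume : Measure ℝ) where
  toFun F := MemLp.toLp (weighted v ω F.1) F.2
  map_add' F G := by
    exact (MemLp.toLp_congr _ _ (weighted_add v ω F.1 G.1)).trans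
      (MemLp.toLp_add (show MemLp (weighted v ω F.1) 2 volume from F.2) G.2)
  map_smul' c F := by
    exact (MemLp.toLp_congr _ _ (weighted_smul v ω c F.1)).trans
      (MemLp.toLp_const_smul c (show MemLp (weighted v ω F.1) 2 volume from F.2))

theorem weightedMap_injective (v : AdmissibleWeight) (ω : ℝ) :
    Function.Injective (weightedMap v ω) := by
  rw [injective_iff_map_eq_zero]
  intro F hF
  have h0 : weighted v ω F.1 =ᵐ[volume] 0 := by
    have h1 : MemLp.toLp (weighted v ω F.1) F.2 = MemLp.toLp (0 : ℝ → ℂ) MemLp.zero := by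
      rw [MemLp.toLp_zero]; exact hF
    exact (MemLp.toLp_eq_toLp_iff _ _).1 h1
  have h2 : ∀ᵐ s : ℝ, (𝓕⁻ F.1 : Lp ℂ 2 (volume : Measure ℝ)) (s / (2 * Real.pi)) = 0 := by
    filter_upwards [h0] with s hs
    have hv : ((v s * Real.exp (ω * |s|) : ℝ) : ℂ) ≠ 0 := by
      have := v.one_le s
      exact_mod_cast (mul_pos (by linarith) (Real.exp_pos _)).ne'
    have hp : (2 * (Real.pi : ℂ))⁻¹ ≠ 0 := by
      have := Real.pi_ne_zero
      simp [this]
    exact (mul_eq_zero.1 ((mul_eq_zero.1 hs).resolve_left hv)).resolve_left hp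
  have h3 : ∀ᵐ s : ℝ, (𝓕⁻ F.1 : Lp ℂ 2 (volume : Measure ℝ)) s = 0 := by
    have hc : 2 * Real.pi ≠ 0 := by positivity
    have hq : Measure.QuasiMeasurePreserving (fun s : ℝ => s * (2 * Real.pi)) volume volume := by
      refine ⟨by fun_prop, ?_⟩
      rw [Real.map_volume_mul_right hc]
      exact Measure.smul_absolutelyContinuous
    have h4 := hq.ae h2
    filter_upwards [h4] with s hs
    simpa [mul_div_assoc, div_self hc] using hs
  have h5 : (𝓕⁻ F.1 : Lp ℂ 2 (volume : Measure ℝ)) = 0 := (Lp.eq_zero_iff_ae_eq_zero).2 h3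
  have h6 : F.1 = 0 := by
    rw [← FourierTransform.fourier_fourierInv_eq F.1 (F := Lp ℂ 2 (volume : Measure ℝ)), h5]
    exact map_zero (Lp.fourierTransformₗᵢ ℝ ℂ)
  exact Subtype.ext h6

/-- The generalized Sobolev space `W²_v(S_ω)`, with the norm
`‖F‖ = ‖v e^{ω|·|} F^∨‖_{L²(ℝ)}` (and not the norm of `L²(ℝ)`). -/
def SobolevStrip (v : AdmissibleWeight) (ω : ℝ) : Type := sobolevSubmodule v ω

instance (v : AdmissibleWeight) (ω : ℝ) : AddCommGroup (SobolevStrip v ω) :=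
  inferInstanceAs (AddCommGroup (sobolevSubmodule v ω))

instance (v : AdmissibleWeight) (ω : ℝ) : Module ℂ (SobolevStrip v ω) :=
  inferInstanceAs (Module ℂ (sobolevSubmodule v ω))

/-- An element of the Sobolev space as an element of `L²(ℝ)`. -/
def SobolevStrip.toL2 {v : AdmissibleWeight} {ω : ℝ} (F : SobolevStrip v ω) :
    Lp ℂ 2 (volume : Measure ℝ) := Subtype.val (p := (· ∈ sobolevSubmodule v ω)) F

/-- `F ↦ v e^{ω|·|} F^∨`, from `W²_v(S_ω)` to `L²(ℝ)`. -/
def SobolevStrip.toWeighted (v : AdmissibleWeight) (ω : ℝ) :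
    SobolevStrip v ω →ₗ[ℂ] Lp ℂ 2 (volume : Measure ℝ) := weightedMap v ω

instance (v : AdmissibleWeight) (ω : ℝ) : NormedAddCommGroup (SobolevStrip v ω) :=
  NormedAddCommGroup.induced _ _ (SobolevStrip.toWeighted v ω)
    (weightedMap_injective v ω)

instance (v : AdmissibleWeight) (ω : ℝ) : NormedSpace ℂ (SobolevStrip v ω) :=
  NormedSpace.induced ℂ _ _ (SobolevStrip.toWeighted v ω)

/-- The inverse Fourier transform of an element of `W²_v(S_ω)`. -/
def SobolevStrip.inv {v : AdmissibleWeight} {ω : ℝ} (F : SobolevStrip v ω) : ℝ → ℂ :=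
  invFourier F.toL2

/-- `h`, as a function on `S_ω`, is the element `F` of `W²_v(S_ω)`: it agrees with `F` almost
everywhere on `ℝ`, and if `ω > 0`, it is on all of `S_ω` the holomorphic function
`h z = ∫ F^∨(s) e^{-isz} ds`. -/
def Represents {v : AdmissibleWeight} {ω : ℝ} (h : ℂ → ℂ) (F : SobolevStrip v ω) : Prop :=
  (fun x : ℝ => h x) =ᵐ[volume] F.toL2 ∧
    (0 < ω → ∀ z ∈ strip ω, h z = ∫ s : ℝ, F.inv s * Complex.exp (-Complex.I * s * z))

theorem Represents.unique {v : AdmissibleWeight} {ω : ℝ} {h : ℂ → ℂ} {F G : SobolevStrip v ω}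
    (hF : Represents h F) (hG : Represents h G) : F = G :=
  Subtype.ext (Lp.ext (hF.1.symm.trans hG.1))

/-- The function `h` on `S_ω` belongs to `W²_v(S_ω)`. -/
def MemSobolev (v : AdmissibleWeight) (ω : ℝ) (h : ℂ → ℂ) : Prop :=
  ∃ F : SobolevStrip v ω, Represents h F

open Classical in
/-- The function `h` on `S_ω` as an element of `W²_v(S_ω)` (zero if `h` does not belong to that
space). -/
def toSobolev (v : AdmissibleWeight) (ω : ℝ) (h : ℂ → ℂ) : SobolevStrip v ω :=
  if hh : MemSobolev v ω h then hh.choose else 0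

theorem represents_toSobolev {v : AdmissibleWeight} {ω : ℝ} {h : ℂ → ℂ} (hh : MemSobolev v ω h) :
    Represents h (toSobolev v ω h) := by
  rw [toSobolev, dif_pos hh]
  exact hh.choose_spec

/-- `f`, as a function on `S_ω`, is generalized Hörmander with respect to `ψ`. -/
def MemHormander (v : AdmissibleWeight) (ω : ℝ) (ψ f : ℂ → ℂ) : Prop :=
  (∀ t : ℝ, MemSobolev v ω (translate (t : ℂ) ψ * f)) ∧
    BddAbove (Set.range fun t : ℝ => ‖toSobolev v ω (translate (t : ℂ) ψ * f)‖)

/-- The norm of the Hörmander space, `sup_t ‖τ_t ψ · f‖` in `W²_v(S_ω)`. -/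
def hormanderNorm (v : AdmissibleWeight) (ω : ℝ) (ψ f : ℂ → ℂ) : ℝ :=
  ⨆ t : ℝ, ‖toSobolev v ω (translate (t : ℂ) ψ * f)‖

end StripHormander

end

open StripHormander

open StripHormander
open Filter Topology

namespace StripHormander

/-! ### Strips and horizontal integrals -/

/-! Everything reduces to one multiplier estimate (`exists_boundedSobolev_mul_hormander`): if `χ` is
holomorphic on a strip of height `ρ > ω` and `‖χ z‖ ≤ A / (1 + (Re z - b)²)` there, then `χ f` lies
in the Sobolev space with norm at most `K A ‖f‖`, with `K` independent of the centre `b`.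

Two facts give this estimate. First, such a `χ` acts on the Sobolev space itself
(`exists_boundedSobolev_mul`): shifting the contour shows that its inverse Fourier transform is `O(A
e^{-a|s|})` with some `a > ω`, an admissible weight grows subexponentially, and so convolution with
this kernel preserves the weighted `L²` space and even yields a continuous function with a weighted
sup bound. Second, translates of `ψ` along a fine lattice give a holomorphic partition of unity `∑
η(z - εn) ψ(z - εn) = 1` (`exists_partition`): Riemann sums of `ψ*ψ`, where `ψ*(z)` is the conjugate
of `ψ` at the conjugate point, converge uniformly to `∫ |ψ|² ≠ 0`, so for small `ε` they can be
divided by. Then `χ f = ∑ (χ τ_{εn}η)(τ_{εn}ψ f)`, and the `n`-th multiplier has size `O(A / (1 +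
(εn - b)²))`, which is summable uniformly in `b`.

Applied to `τ_z φ`, which decays about `b = Re z` with a constant independent of `z`, the estimate
gives the uniform bounds. Applied to a Taylor remainder of `τ_w φ` it gives holomorphy. Real
translates of `ψ'` give independence of the localizing function, and the representation formula is
evaluation at `z`, where `τ_z φ` equals `φ 0`. -/

theorem mem_strip_iff {ρ : ℝ} (hρ : 0 < ρ) {z : ℂ} : z ∈ strip ρ ↔ |z.im| < ρ := by
  simp [strip, hρ.ne']

theorem ofReal_mem_strip {ω : ℝ} (hω : 0 ≤ ω) (x : ℝ) : (x : ℂ) ∈ strip ω := by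
  rcases hω.eq_or_lt with h | h
  · exact Or.inr ⟨h.symm, by simp⟩
  · exact (mem_strip_iff h).2 (by simpa using h)

theorem strip_subset_strip {ω ρ : ℝ} (hω : 0 ≤ ω) (h : ω < ρ) : strip ω ⊆ strip ρ := by
  intro z hz
  refine (mem_strip_iff (hω.trans_lt h)).2 ?_
  rcases hz with hz | ⟨h0, hz⟩
  · exact hz.trans h
  · rw [hz, abs_zero]; exact hω.trans_lt h

theorem isOpen_strip {ρ : ℝ} (hρ : 0 < ρ) : IsOpen (strip ρ) := by
  have : strip ρ = {z | |z.im| < ρ} := by ext z; exact mem_strip_iff hρ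
  rw [this]
  exact isOpen_lt (by fun_prop) continuous_const

theorem convex_strip {ρ : ℝ} (hρ : 0 < ρ) : Convex ℝ (strip ρ) := by
  have : strip ρ = Complex.imLm ⁻¹' (Set.Ioo (-ρ) ρ) := by
    ext z; simp [mem_strip_iff hρ, abs_lt]
  rw [this]
  exact (convex_Ioo _ _).linear_preimage _

theorem integrable_decay (B b : ℝ) : Integrable (fun x : ℝ => B / (1 + (x - b) ^ 2)) := by
  have h := (integrable_inv_one_add_sq.comp_sub_right b).const_mul B
  simpa [div_eq_mul_inv] using h

theorem integral_decay (B b : ℝ) : ∫ x : ℝ, B / (1 + (x - b) ^ 2) = B * Real.pi := by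
  have h := integral_sub_right_eq_self (μ := volume) (fun x : ℝ => (1 + x ^ 2)⁻¹) b
  rw [integral_univ_inv_one_add_sq] at h
  simp only [div_eq_mul_inv]
  rw [integral_const_mul, h]

theorem continuous_horizontal {H : ℂ → ℂ} {ρ y : ℝ} (hd : DifferentiableOn ℂ H (strip ρ))
    (hy : |y| < ρ) : Continuous fun x : ℝ => H (x + y * Complex.I) := by
  have hρ : 0 < ρ := (abs_nonneg y).trans_lt hy
  refine hd.continuousOn.comp_continuous (by fun_prop) fun x => (mem_strip_iff hρ).2 ?_
  simpa using hy

theorem integrable_horizontal {H : ℂ → ℂ} {ρ B b y : ℝ} (hd : DifferentiableOn ℂ H (strip ρ))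
    (hB : ∀ z ∈ strip ρ, |z.im| ≤ |y| → ‖H z‖ ≤ B / (1 + (z.re - b) ^ 2)) (hy : |y| < ρ) :
    Integrable fun x : ℝ => H (x + y * Complex.I) := by
  have hρ : 0 < ρ := (abs_nonneg y).trans_lt hy
  refine (integrable_decay B b).mono' (continuous_horizontal hd hy).aestronglyMeasurable
    (ae_of_all _ fun x => ?_)
  have := hB (x + y * Complex.I) ((mem_strip_iff hρ).2 (by simpa using hy)) (by simp)
  simpa using this

theorem tendsto_decay_atTop (B b : ℝ) :
    Tendsto (fun x : ℝ => B / (1 + (x - b) ^ 2)) atTop (𝓝 0) := by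
  refine tendsto_const_nhds.div_atTop (tendsto_atTop_add_const_left _ _ ?_)
  exact (tendsto_pow_atTop two_ne_zero).comp (tendsto_atTop_add_const_right _ _ tendsto_id)

/-- Cauchy's theorem on the rectangle between heights `0` and `y`, whose vertical sides vanish in
the limit. The bound is needed only up to height `|y|`, which allows integrands with a factor
`e^{isz}`. -/
theorem integral_horizontal_eq {H : ℂ → ℂ} {ρ B b y : ℝ} (hd : DifferentiableOn ℂ H (strip ρ))
    (hB : ∀ z ∈ strip ρ, |z.im| ≤ |y| → ‖H z‖ ≤ B / (1 + (z.re - b) ^ 2)) (hy : |y| < ρ) :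
    ∫ x : ℝ, H (x + y * Complex.I) = ∫ x : ℝ, H x := by
  have hρ : 0 < ρ := (abs_nonneg y).trans_lt hy
  have hmem : ∀ (R t : ℝ), |t| ≤ |y| → (R + t * Complex.I : ℂ) ∈ strip ρ := fun R t ht =>
    (mem_strip_iff hρ).2 (by simpa using ht.trans_lt hy)
  have h0 : Integrable fun x : ℝ => H x := by
    have := integrable_horizontal (y := 0) hd
      (fun z hz h => hB z hz (h.trans (by simp))) (by simpa using hρ)
    simpa using this
  -- The two error terms come from the vertical sides at `R` and `-R`, each of length `|y|`.
  have hint : ∀ R : ℝ, ‖(∫ x in (-R)..R, H (x + y * Complex.I)) - ∫ x in (-R)..R, H x‖ ≤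
      B / (1 + (R - b) ^ 2) * |y| + B / (1 + (R - (-b)) ^ 2) * |y| := by
    intro R
    have key := Complex.integral_boundary_rect_eq_zero_of_differentiableOn H (-R : ℝ)
      (R + y * Complex.I) (hd.mono fun z hz => by
        rw [Complex.mem_reProdIm] at hz
        have h2 := hz.2
        simp only [Complex.ofReal_im, Complex.add_im, Complex.mul_im, Complex.ofReal_re,
          Complex.I_im, mul_one, Complex.I_re, mul_zero, add_zero, zero_add] at h2
        refine (mem_strip_iff hρ).2 (lt_of_le_of_lt ?_ hy)
        simpa using Set.abs_sub_left_of_mem_uIcc h2)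
    simp only [Complex.ofReal_re, Complex.ofReal_im, Complex.add_re, Complex.add_im,
      Complex.mul_re, Complex.mul_im, Complex.I_re, Complex.I_im, mul_zero, mul_one, sub_zero,
      add_zero, zero_add, zero_mul, Complex.ofReal_zero] at key
    have e : (∫ x in (-R)..R, H (x + y * Complex.I)) - ∫ x in (-R)..R, H x =
        Complex.I • (∫ t in (0 : ℝ)..y, H (R + t * Complex.I)) -
          Complex.I • ∫ t in (0 : ℝ)..y, H ((-R : ℝ) + t * Complex.I) := by
      linear_combination -key
    have hI : ∀ t ∈ Set.uIoc 0 y, |t| ≤ |y| := fun t ht => by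
      simpa using Set.abs_sub_left_of_mem_uIcc (Set.uIoc_subset_uIcc ht)
    rw [e]
    refine (norm_sub_le _ _).trans (add_le_add ?_ ?_)
    · rw [norm_smul, Complex.norm_I, one_mul]
      have := intervalIntegral.norm_integral_le_of_norm_le_const (a := 0) (b := y)
        (f := fun t : ℝ => H (R + t * Complex.I)) (C := B / (1 + (R - b) ^ 2)) (fun t ht => by
          simpa using hB _ (hmem R t (hI t ht)) (by simpa using hI t ht))
      simpa using this
    · rw [norm_smul, Complex.norm_I, one_mul]
      have := intervalIntegral.norm_integral_le_of_norm_le_const (a := 0) (b := y)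
        (f := fun t : ℝ => H ((-R : ℝ) + t * Complex.I)) (C := B / (1 + (R - (-b)) ^ 2))
        (fun t ht => by
          have := hB _ (hmem (-R) t (hI t ht)) (by simpa using hI t ht)
          have e : (-R - b) ^ 2 = (R - (-b)) ^ 2 := by ring
          simpa [e] using this)
      simpa using this
  have t1 := intervalIntegral_tendsto_integral (integrable_horizontal hd hB hy)
    tendsto_neg_atTop_atBot tendsto_id
  have t2 := intervalIntegral_tendsto_integral h0 tendsto_neg_atTop_atBot tendsto_id
  have t3 : Tendsto (fun R : ℝ => B / (1 + (R - b) ^ 2) * |y| + B / (1 + (R - (-b)) ^ 2) * |y|)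
      atTop (𝓝 0) := by
    simpa using ((tendsto_decay_atTop B b).mul_const |y|).add
      ((tendsto_decay_atTop B (-b)).mul_const |y|)
  have t4 := squeeze_zero_norm hint t3
  exact sub_eq_zero.1 (tendsto_nhds_unique (t1.sub t2) t4)

/-! ### Cauchy estimates on strips -/

/-- From `(x - b)² ≤ 2(x' - b)² + 2`: moving the point by at most `1` costs a factor `4`. -/
theorem decay_le_decay {A b x x' : ℝ} (hA : 0 ≤ A) (h : |x' - x| ≤ 1) :
    A / (1 + (x' - b) ^ 2) ≤ 4 * A / (1 + (x - b) ^ 2) := by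
  rw [div_le_div_iff₀ (by positivity) (by positivity)]
  have h1 : (x' - x) ^ 2 ≤ 1 := by
    rw [← sq_abs]; exact pow_le_one₀ (abs_nonneg _) h
  have h2 : (1 + (x - b) ^ 2) ≤ 4 * (1 + (x' - b) ^ 2) := by
    nlinarith [sq_nonneg (x' - b + (x' - x)), sq_nonneg (x' - b)]
  nlinarith [mul_le_mul_of_nonneg_left h2 hA]

/-- On a smaller strip, the derivative inherits the quadratic decay. -/
theorem norm_deriv_le_decay {H : ℂ → ℂ} {ρ ρ' A b : ℝ} (hρ' : 0 < ρ') (hρ : ρ' < ρ) (hA : 0 ≤ A)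
    (hd : DifferentiableOn ℂ H (strip ρ))
    (hB : ∀ z ∈ strip ρ, ‖H z‖ ≤ A / (1 + (z.re - b) ^ 2)) {z : ℂ} (hz : z ∈ strip ρ') :
    ‖deriv H z‖ ≤ 4 * A / min 1 ((ρ - ρ') / 2) / (1 + (z.re - b) ^ 2) := by
  -- Radius of the Cauchy estimate: at most `1`, so that the decay changes only by the factor `4`,
  -- and small enough to keep the disc in the larger strip.
  set r := min 1 ((ρ - ρ') / 2) with hr
  have hr0 : 0 < r := lt_min one_pos (by linarith)
  have hr1 : r ≤ 1 := min_le_left _ _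
  have hr2 : r ≤ (ρ - ρ') / 2 := min_le_right _ _
  rw [mem_strip_iff hρ'] at hz
  have hsub : Metric.closedBall z r ⊆ strip ρ := fun w hw => by
    rw [mem_strip_iff (hρ'.trans hρ)]
    have h1 := (Complex.abs_im_le_norm (w - z)).trans (by simpa [dist_eq_norm] using hw)
    rw [Complex.sub_im] at h1
    have := abs_sub_abs_le_abs_sub w.im z.im
    linarith
  have h := Complex.norm_deriv_le_of_forall_mem_sphere_norm_le (f := H) (c := z)
    (C := 4 * A / (1 + (z.re - b) ^ 2)) hr0
    (hd.mono (Metric.closure_ball_subset_closedBall.trans hsub)).diffContOnCl (fun w hw => by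
      refine (hB w (hsub (Metric.sphere_subset_closedBall hw))).trans (decay_le_decay hA ?_)
      have h1 := (Complex.abs_re_le_norm (w - z)).trans
        (by simpa [dist_eq_norm] using Metric.sphere_subset_closedBall hw)
      rw [Complex.sub_re] at h1
      exact h1.trans hr1)
  calc _ ≤ _ := h
    _ = _ := by rw [div_right_comm]

/-- Mean value inequality on the segment. One factor `4` of the `16` comes from the derivative
bound, the other from recentring the decay at `z`. -/
theorem norm_sub_le_decay {H : ℂ → ℂ} {ρ ρ' A b : ℝ} (hρ' : 0 < ρ') (hρ : ρ' < ρ) (hA : 0 ≤ A)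
    (hd : DifferentiableOn ℂ H (strip ρ))
    (hB : ∀ z ∈ strip ρ, ‖H z‖ ≤ A / (1 + (z.re - b) ^ 2)) {z w : ℂ} (hz : z ∈ strip ρ')
    (hw : w ∈ strip ρ') (hzw : ‖w - z‖ ≤ 1) :
    ‖H w - H z‖ ≤ 16 * A / min 1 ((ρ - ρ') / 2) / (1 + (z.re - b) ^ 2) * ‖w - z‖ := by
  have hr0 : 0 < min 1 ((ρ - ρ') / 2) := lt_min one_pos (by linarith)
  have hseg : segment ℝ z w ⊆ strip ρ' := (convex_strip hρ').segment_subset hz hw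
  refine (convex_segment z w).norm_image_sub_le_of_norm_deriv_le (𝕜 := ℂ) (fun u hu =>
    hd.differentiableAt ((isOpen_strip (hρ'.trans hρ)).mem_nhds
      (strip_subset_strip hρ'.le hρ (hseg hu)))) (fun u hu => ?_)
    (left_mem_segment _ _ _) (right_mem_segment _ _ _)
  have h1 : ‖u - z‖ ≤ 1 := (norm_sub_le_of_mem_segment hu).trans hzw
  have h2 : |u.re - z.re| ≤ 1 := by
    rw [← Complex.sub_re]; exact (Complex.abs_re_le_norm _).trans h1
  refine (norm_deriv_le_decay hρ' hρ hA hd hB (hseg hu)).trans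
    ((decay_le_decay (by positivity) h2).trans_eq ?_)
  ring

/-- The first order Taylor remainder on a smaller strip, with quadratic decay. -/
theorem norm_taylor_le_decay {H : ℂ → ℂ} {ρ ρ' A b : ℝ} (hρ' : 0 < ρ') (hρ : ρ' < ρ) (hA : 0 ≤ A)
    (hd : DifferentiableOn ℂ H (strip ρ))
    (hB : ∀ z ∈ strip ρ, ‖H z‖ ≤ A / (1 + (z.re - b) ^ 2)) :
    ∃ C : ℝ, 0 ≤ C ∧ ∀ z ∈ strip ρ', ∀ w ∈ strip ρ', ‖w - z‖ ≤ 1 →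
      ‖H w - H z - (w - z) * deriv H z‖ ≤ C * ‖w - z‖ ^ 2 / (1 + (z.re - b) ^ 2) := by
  -- The intermediate strip is used twice: Cauchy's estimate bounds `deriv H` on it, and the
  -- difference estimate for `deriv H` then loses the rest of the height.
  set σ := (ρ + ρ') / 2
  have h1 : ρ' < σ := by simp only [σ]; linarith
  have h2 : σ < ρ := by simp only [σ]; linarith
  have hσ : 0 < σ := hρ'.trans h1
  have hr0 : 0 < min 1 ((ρ - σ) / 2) := lt_min one_pos (by linarith)
  have hr1 : 0 < min 1 ((σ - ρ') / 2) := lt_min one_pos (by linarith)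
  set A' := 4 * A / min 1 ((ρ - σ) / 2)
  have hA' : 0 ≤ A' := by positivity
  have hd' : DifferentiableOn ℂ (deriv H) (strip σ) :=
    (hd.deriv (isOpen_strip (hσ.trans h2))).mono (strip_subset_strip hσ.le h2)
  have hB' : ∀ z ∈ strip σ, ‖deriv H z‖ ≤ A' / (1 + (z.re - b) ^ 2) := fun z hz =>
    norm_deriv_le_decay hσ h2 hA hd hB hz
  refine ⟨16 * A' / min 1 ((σ - ρ') / 2), by positivity, fun z hz w hw hzw => ?_⟩
  have hseg : segment ℝ z w ⊆ strip ρ' := (convex_strip hρ').segment_subset hz hw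
  -- With the linear part subtracted, the derivative on the segment is `O(‖w - z‖)`, so the mean
  -- value inequality gives the square.
  have hdu : ∀ u ∈ segment ℝ z w, HasDerivAt (fun u => H u - u * deriv H z)
      (deriv H u - deriv H z) u := fun u hu => by
    have := (hd.differentiableAt ((isOpen_strip (hσ.trans h2)).mem_nhds
      (strip_subset_strip hρ'.le hρ (hseg hu)))).hasDerivAt
    have h := this.sub ((hasDerivAt_id u).mul_const (deriv H z))
    rw [one_mul] at h
    exact h
  have := (convex_segment z w).norm_image_sub_le_of_norm_hasDerivWithin_le (𝕜 := ℂ)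
    (C := 16 * A' / min 1 ((σ - ρ') / 2) / (1 + (z.re - b) ^ 2) * ‖w - z‖)
    (fun u hu => (hdu u hu).hasDerivWithinAt) (fun u hu => by
      have h3 : ‖u - z‖ ≤ ‖w - z‖ := norm_sub_le_of_mem_segment hu
      refine (norm_sub_le_decay hρ' h1 hA' hd' hB' hz (hseg hu) (h3.trans hzw)).trans ?_
      gcongr)
    (left_mem_segment _ _ _) (right_mem_segment _ _ _)
  calc _ = ‖H w - w * deriv H z - (H z - z * deriv H z)‖ := by congr 1; ring
    _ ≤ _ := this
    _ = _ := by ring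

/-! ### Riemann sums over translates -/

/-- Takes the exponent `2k` and uses `(1 + |x|)² ≥ 1 + x²`. -/
theorem exists_decay_of_holSchwartz {f : ℂ → ℂ} {σ : ℝ} (hσ : 0 < σ) (hf : f ∈ HolSchwartz σ) {k : ℕ}
    (hk : 0 < k) :
    ∃ A : ℝ, 0 ≤ A ∧ ∀ z ∈ strip σ, ‖f z‖ ≤ A / (1 + z.re ^ 2) ^ k := by
  obtain ⟨C, hC⟩ := hf.2 ((2 * k : ℕ) : ℝ) (by positivity)
  have hC0 : 0 ≤ C := by
    have := (norm_nonneg _).trans (hC 0 ((mem_strip_iff hσ).2 (by simpa using hσ)))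
    simpa using this
  refine ⟨C, hC0, fun z hz => (hC z hz).trans ?_⟩
  rw [Real.rpow_natCast, pow_mul]
  gcongr
  nlinarith [abs_nonneg z.re, sq_abs z.re]

/-- Comparison with an integral: for `u ∈ [n, n + 1]` the points `εn` and `εu` differ by at most
`1`. The bound does not depend on `x`. -/
theorem summable_decay_int {A ε : ℝ} (x : ℝ) (hA : 0 ≤ A) (hε : 0 < ε) (hε1 : ε ≤ 1) :
    (Summable fun n : ℤ => A / (1 + (ε * n - x) ^ 2)) ∧
      ∑' n : ℤ, A / (1 + (ε * n - x) ^ 2) ≤ 4 * A * Real.pi / ε := by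
  have hi : Integrable fun u : ℝ => 4 * A / (1 + (ε * u - x) ^ 2) :=
    (integrable_decay (4 * A) x).comp_mul_left' hε.ne'
  have hs := hi.hasSum_intervalIntegral 0
  have hval : ∫ u : ℝ, 4 * A / (1 + (ε * u - x) ^ 2) = 4 * A * Real.pi / ε := by
    rw [Measure.integral_comp_mul_left (fun u : ℝ => 4 * A / (1 + (u - x) ^ 2)) ε,
      integral_decay, abs_of_pos (inv_pos.2 hε), smul_eq_mul]
    field_simp
  have hle : ∀ n : ℤ, A / (1 + (ε * n - x) ^ 2) ≤
      ∫ u in (0 + n : ℝ)..0 + n + 1, 4 * A / (1 + (ε * u - x) ^ 2) := fun n => by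
    have := intervalIntegral.integral_mono_on (μ := volume) (a := (0 + n : ℝ)) (b := 0 + n + 1)
      (f := fun _ => A / (1 + (ε * n - x) ^ 2)) (g := fun u => 4 * A / (1 + (ε * u - x) ^ 2))
      (by linarith) intervalIntegrable_const hi.intervalIntegrable (fun u hu => by
        refine decay_le_decay hA ?_
        rw [← mul_sub, abs_mul, abs_of_pos hε]
        have : |n - u| ≤ 1 := by
          rw [abs_le]; constructor <;> linarith [hu.1, hu.2]
        exact mul_le_one₀ hε1 (abs_nonneg _) this)
    simpa using this
  have hnn : ∀ n : ℤ, 0 ≤ A / (1 + (ε * n - x) ^ 2) := fun n => by positivity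
  have hsum := Summable.of_nonneg_of_le hnn hle hs.summable
  refine ⟨hsum, ?_⟩
  rw [← hval, ← hs.tsum_eq]
  exact hsum.tsum_le_tsum hle hs.summable

theorem sub_ofReal_mem_strip {ρ : ℝ} (hρ : 0 < ρ) {z : ℂ} (hz : z ∈ strip ρ) (t : ℝ) :
    z - t ∈ strip ρ := by
  rw [mem_strip_iff hρ] at hz ⊢
  simpa using hz

theorem summable_translates {H : ℂ → ℂ} {ρ A ε : ℝ} (hρ : 0 < ρ) (hA : 0 ≤ A) (hε : 0 < ε)
    (hε1 : ε ≤ 1) (hB : ∀ z ∈ strip ρ, ‖H z‖ ≤ A / (1 + z.re ^ 2)) {z : ℂ} (hz : z ∈ strip ρ) :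
    Summable fun n : ℤ => H (z - (ε * n : ℝ)) := by
  refine Summable.of_norm_bounded (summable_decay_int z.re hA hε hε1).1 fun n => ?_
  refine (hB _ (sub_ofReal_mem_strip hρ hz _)).trans_eq ?_
  rw [Complex.sub_re, Complex.ofReal_re]
  ring

/-- Weierstrass test on unit balls, where recentring the decay at the fixed real part of the
midpoint gives one summable majorant. -/
theorem differentiableOn_tsum_translates {H : ℂ → ℂ} {ρ A ε : ℝ} (hρ : 0 < ρ) (hA : 0 ≤ A)
    (hε : 0 < ε) (hε1 : ε ≤ 1) (hd : DifferentiableOn ℂ H (strip ρ))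
    (hB : ∀ z ∈ strip ρ, ‖H z‖ ≤ A / (1 + z.re ^ 2)) :
    DifferentiableOn ℂ (fun z => ∑' n : ℤ, H (z - (ε * n : ℝ))) (strip ρ) := by
  intro z hz
  have hU : IsOpen (strip ρ ∩ Metric.ball z 1) := (isOpen_strip hρ).inter Metric.isOpen_ball
  have h := Complex.differentiableOn_tsum_of_summable_norm
    (F := fun (n : ℤ) w => H (w - (ε * n : ℝ))) (U := strip ρ ∩ Metric.ball z 1)
    (summable_decay_int z.re (mul_nonneg zero_le_four hA) hε hε1).1
    (fun n => hd.comp (by fun_prop) fun w hw => sub_ofReal_mem_strip hρ hw.1 _) hU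
    (fun n w hw => by
      refine (hB _ (sub_ofReal_mem_strip hρ hw.1 _)).trans ?_
      have h1 : |w.re - z.re| ≤ 1 := by
        rw [← Complex.sub_re]
        exact (Complex.abs_re_le_norm _).trans (by
          rw [← dist_eq_norm]
          exact (Metric.mem_ball.1 hw.2).le)
      have := decay_le_decay (b := ε * n) hA h1
      rw [Complex.sub_re, Complex.ofReal_re]
      refine (le_of_eq ?_).trans (this.trans_eq ?_)
      · ring
      · rw [← neg_sq (z.re - _), neg_sub])
  exact (h.differentiableAt (hU.mem_nhds ⟨hz, Metric.mem_ball_self one_pos⟩)).differentiableWithinAt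

/-- Riemann sums over the translates converge uniformly on a smaller strip. -/
theorem norm_tsum_translates_sub_le {H : ℂ → ℂ} {ρ ρ' A : ℝ} (hρ' : 0 < ρ') (hρ : ρ' < ρ)
    (hA : 0 ≤ A) (hd : DifferentiableOn ℂ H (strip ρ))
    (hB : ∀ z ∈ strip ρ, ‖H z‖ ≤ A / (1 + z.re ^ 2)) :
    ∃ C : ℝ, 0 ≤ C ∧ ∀ ε : ℝ, 0 < ε → ε ≤ 1 → ∀ z ∈ strip ρ',
      ‖ε * (∑' n : ℤ, H (z - (ε * n : ℝ))) - ∫ x : ℝ, H x‖ ≤ C * ε := by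
  have hr0 : 0 < min 1 ((ρ - ρ') / 2) := lt_min one_pos (by linarith)
  set K := 16 * A / min 1 ((ρ - ρ') / 2)
  have hK : 0 ≤ K := by positivity
  have hρ0 := hρ'.trans hρ
  refine ⟨4 * K * Real.pi, by positivity, fun ε hε hε1 z hz => ?_⟩
  have hy : |z.im| < ρ := ((mem_strip_iff hρ').1 hz).trans hρ
  have hzre : ∀ t : ℝ, z - t = ((z.re - t : ℝ) : ℂ) + z.im * Complex.I := fun t => by
    apply Complex.ext <;> simp
  have hB' : ∀ w ∈ strip ρ, |w.im| ≤ |z.im| → ‖H w‖ ≤ A / (1 + (w.re - 0) ^ 2) :=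
    fun w hw _ => by simpa using hB w hw
  have hi0 : Integrable fun t : ℝ => H (z - t) := by
    simp only [hzre]
    exact (integrable_horizontal hd hB' hy).comp_sub_left z.re
  have hi : Integrable fun u : ℝ => H (z - (ε * u : ℝ)) := hi0.comp_mul_left' hε.ne'
  -- The contour shift makes the integral independent of the height of `z`.
  have hval : ∫ u : ℝ, H (z - (ε * u : ℝ)) = (ε : ℂ)⁻¹ * ∫ x : ℝ, H x := by
    rw [Measure.integral_comp_mul_left (fun t : ℝ => H (z - t)) ε, abs_of_pos (inv_pos.2 hε)]
    simp only [hzre]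
    rw [integral_sub_left_eq_self (fun t : ℝ => H (t + z.im * Complex.I)) volume z.re,
      integral_horizontal_eq hd hB' hy]
    simp
  have hs := hi.hasSum_intervalIntegral 0
  rw [hval] at hs
  have hsum := summable_translates hρ0 hA hε hε1 hB (strip_subset_strip hρ'.le hρ hz)
  have hdiff := hsum.hasSum.sub hs
  have hb := summable_decay_int z.re (mul_nonneg hK hε.le) hε hε1
  -- Each term is compared with its mean over `[n, n + 1]`. The error `Kε / (1 + (εn - Re z)²)` sums
  -- to `O(1)`, since the sum over `n` costs only `1/ε`.
  have hn : ‖(∑' n : ℤ, H (z - (ε * n : ℝ))) - (ε : ℂ)⁻¹ * ∫ x : ℝ, H x‖ ≤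
      4 * (K * ε) * Real.pi / ε := by
    refine le_trans ?_ hb.2
    rw [← hdiff.tsum_eq]
    refine tsum_of_norm_bounded hb.1.hasSum fun n => ?_
    have e : H (z - (ε * n : ℝ)) = ∫ u in (0 + n : ℝ)..0 + n + 1, H (z - (ε * n : ℝ)) := by simp
    rw [e, ← intervalIntegral.integral_sub intervalIntegrable_const hi.intervalIntegrable]
    have := intervalIntegral.norm_integral_le_of_norm_le_const (a := (0 + n : ℝ))
      (b := 0 + n + 1) (f := fun u : ℝ => H (z - (ε * n : ℝ)) - H (z - (ε * u : ℝ)))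
      (C := K * ε / (1 + (ε * n - z.re) ^ 2)) (fun u hu => by
        rw [Set.uIoc_of_le (by linarith)] at hu
        have h1 : ‖z - (ε * u : ℝ) - (z - (ε * n : ℝ))‖ ≤ ε := by
          have : z - (ε * u : ℝ) - (z - (ε * n : ℝ)) = ((ε * (n - u) : ℝ) : ℂ) := by
            push_cast; ring
          rw [this, Complex.norm_real, Real.norm_eq_abs, abs_mul, abs_of_pos hε]
          have : |n - u| ≤ 1 := by rw [abs_le]; constructor <;> linarith [hu.1, hu.2]
          nlinarith
        rw [norm_sub_rev]
        refine (norm_sub_le_decay (b := 0) hρ' hρ hA hd (fun w hw => by simpa using hB w hw)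
          (sub_ofReal_mem_strip hρ' hz (ε * n)) (sub_ofReal_mem_strip hρ' hz (ε * u))
          (h1.trans hε1)).trans ((mul_le_mul_of_nonneg_left h1 (by positivity)).trans_eq ?_)
        rw [Complex.sub_re, Complex.ofReal_re, sub_zero, ← neg_sq (z.re - _), neg_sub]
        ring)
    simpa using this
  have hε' : (ε : ℂ) ≠ 0 := by exact_mod_cast hε.ne'
  calc _ = ‖(ε : ℂ) * ((∑' n : ℤ, H (z - (ε * n : ℝ))) - (ε : ℂ)⁻¹ * ∫ x : ℝ, H x)‖ := by
        congr 1; field_simp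
    _ = ε * ‖(∑' n : ℤ, H (z - (ε * n : ℝ))) - (ε : ℂ)⁻¹ * ∫ x : ℝ, H x‖ := by
        rw [norm_mul, Complex.norm_real, Real.norm_eq_abs, abs_of_pos hε]
    _ ≤ ε * (4 * (K * ε) * Real.pi / ε) := by gcongr
    _ = _ := by field_simp

open ComplexConjugate in
/-- A holomorphic partition of unity from the translates of `ψ` along a fine lattice. -/
theorem exists_partition {ψ : ℂ → ℂ} {ω ρ σ : ℝ} (hω : 0 ≤ ω) (hσ : ω < σ) (hρ : 0 < ρ)
    (hρσ : ρ < σ) (hψ : ψ ∈ HolSchwartz σ) (hψ0 : ∃ z ∈ strip ω, ψ z ≠ 0) :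
    ∃ ε : ℝ, 0 < ε ∧ ε ≤ 1 ∧ ∃ (η : ℂ → ℂ) (C : ℝ), 0 ≤ C ∧ DifferentiableOn ℂ η (strip ρ) ∧
      (∀ z ∈ strip ρ, ‖η z‖ ≤ C / (1 + z.re ^ 2) ^ 2) ∧
      ∀ z ∈ strip ρ, HasSum (fun n : ℤ => η (z - (ε * n : ℝ)) * ψ (z - (ε * n : ℝ))) 1 := by
  have hσ0 : 0 < σ := hω.trans_lt hσ
  have hconj : ∀ {z : ℂ}, z ∈ strip σ → conj z ∈ strip σ := fun {z} hz => by
    rw [mem_strip_iff hσ0] at hz ⊢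
    simpa using hz
  -- This reflection is holomorphic, and `ψc * ψ` equals `|ψ|²` on the real line.
  set ψc : ℂ → ℂ := fun z => conj (ψ (conj z)) with hψc
  have hψcd : DifferentiableOn ℂ ψc (strip σ) := fun z hz => by
    have h := (hψ.1.differentiableAt ((isOpen_strip hσ0).mem_nhds (hconj hz))).conj_conj
    rw [Complex.conj_conj] at h
    exact h.differentiableWithinAt
  obtain ⟨A, hA, hψA⟩ := exists_decay_of_holSchwartz hσ0 hψ one_pos
  -- Two powers of decay: `decay_mul_decay_le` later spends one on summability and keeps the other.
  obtain ⟨A2, hA2, hψA2⟩ := exists_decay_of_holSchwartz hσ0 hψ two_pos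
  have hψcA : ∀ z ∈ strip σ, ‖ψc z‖ ≤ A2 / (1 + z.re ^ 2) ^ 2 := fun z hz => by
    simpa [hψc] using hψA2 _ (hconj hz)
  set H : ℂ → ℂ := fun z => ψc z * ψ z with hH
  have hHd : DifferentiableOn ℂ H (strip σ) := hψcd.mul hψ.1
  have hHB : ∀ z ∈ strip σ, ‖H z‖ ≤ (A2 * A) / (1 + z.re ^ 2) := fun z hz => by
    rw [hH, norm_mul]
    have h1 : (1 : ℝ) ≤ 1 + z.re ^ 2 := by nlinarith [sq_nonneg z.re]
    have h2 : ‖ψc z‖ ≤ A2 := (hψcA z hz).trans (div_le_self hA2 (one_le_pow₀ h1))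
    have h3 : ‖ψ z‖ ≤ A / (1 + z.re ^ 2) := by simpa using hψA z hz
    calc _ ≤ A2 * (A / (1 + z.re ^ 2)) := by gcongr
      _ = _ := by ring
  have hAA : 0 ≤ A2 * A := mul_nonneg hA2 hA
  have hHreal : ∀ x : ℝ, H x = ((‖ψ x‖ ^ 2 : ℝ) : ℂ) := fun x => by
    simp only [hH, hψc, Complex.conj_ofReal]
    rw [Complex.conj_mul']
    push_cast
    rfl
  have hcont : Continuous fun x : ℝ => ψ x := by
    have := continuous_horizontal (y := 0) hψ.1 (by simpa using hσ0)
    simpa using this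
  have hHint : Integrable fun x : ℝ => H x := by
    have := integrable_horizontal (y := 0) (b := 0) hHd
      (fun z hz _ => by simpa using hHB z hz) (by simpa using hσ0)
    simpa using this
  -- If the integral vanished, `ψ` would vanish on `ℝ`, hence on the whole strip by the identity
  -- theorem at `0`.
  have hc : ∫ x : ℝ, H x ≠ 0 := by
    intro h0
    simp only [hHreal] at h0 hHint
    rw [integral_complex_ofReal, Complex.ofReal_eq_zero,
      integral_eq_zero_iff_of_nonneg (fun x => by positivity) (by
        refine hHint.re.congr (ae_of_all _ fun x => ?_)
        exact Complex.ofReal_re _)] at h0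
    have h1 : (fun x : ℝ => ‖ψ x‖ ^ 2) = 0 :=
      (Continuous.ae_eq_iff_eq volume (hcont.norm.pow 2) continuous_zero).1 h0
    have h2 : ∀ x : ℝ, ψ x = 0 := fun x => by
      have := congrFun h1 x
      simpa using this
    have h3 := (hψ.1.analyticOnNhd
      (isOpen_strip hσ0)).eqOn_zero_of_preconnected_of_mem_closure
        (convex_strip hσ0).isPreconnected (ofReal_mem_strip hσ0.le 0) (by
          rw [Complex.ofReal_zero, mem_closure_iff_seq_limit]
          refine ⟨fun n : ℕ => ((1 / ((n : ℝ) + 1) : ℝ) : ℂ), fun n => ⟨h2 _, ?_⟩, ?_⟩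
          · simp only [Set.mem_singleton_iff, Complex.ofReal_eq_zero]
            positivity
          · exact (Complex.continuous_ofReal.tendsto' 0 0 rfl).comp
              tendsto_one_div_add_atTop_nhds_zero_nat)
    obtain ⟨z, hz, hz0⟩ := hψ0
    exact hz0 (h3 (strip_subset_strip hω hσ hz))
  set c := ∫ x : ℝ, H x with hcdef
  obtain ⟨C, hC, hsumC⟩ := norm_tsum_translates_sub_le hρ hρσ hAA hHd hHB
  have hcn : 0 < ‖c‖ := norm_pos_iff.2 hc
  -- This makes `Cε ≤ ‖c‖/2`, so `ε Φ` stays at distance at least `‖c‖/2` from `0`. The `+ 1` covers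
  -- `C = 0`.
  set ε := min 1 (‖c‖ / 2 / (C + 1)) with hεd
  have hε : 0 < ε := lt_min one_pos (by positivity)
  have hε1 : ε ≤ 1 := min_le_left _ _
  have hεC : C * ε ≤ ‖c‖ / 2 := by
    have h1 : ε ≤ ‖c‖ / 2 / (C + 1) := min_le_right _ _
    rw [le_div_iff₀ (by positivity)] at h1
    nlinarith
  set Φ : ℂ → ℂ := fun z => ∑' n : ℤ, H (z - (ε * n : ℝ)) with hΦ
  have hsub : strip ρ ⊆ strip σ := strip_subset_strip hρ.le hρσ
  have hΦn : ∀ z ∈ strip ρ, ‖c‖ / 2 ≤ ‖Φ z‖ := fun z hz => by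
    have h1 := (hsumC ε hε hε1 z hz).trans hεC
    have h2 : ‖c‖ - ‖ε * Φ z‖ ≤ ‖ε * Φ z - c‖ := by
      rw [norm_sub_rev]; exact norm_sub_norm_le _ _
    rw [norm_mul, Complex.norm_real, Real.norm_eq_abs, abs_of_pos hε] at h2
    have h3 : ε * ‖Φ z‖ ≤ 1 * ‖Φ z‖ := by gcongr
    linarith
  have hΦ0 : ∀ z ∈ strip ρ, Φ z ≠ 0 := fun z hz =>
    norm_pos_iff.1 (lt_of_lt_of_le (by positivity) (hΦn z hz))
  -- Periodicity of `Φ` lets the division by `Φ z` be carried out inside every lattice translate.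
  have hper : ∀ (z : ℂ) (m : ℤ), Φ (z - (ε * m : ℝ)) = Φ z := fun z m => by
    simp only [hΦ]
    rw [← (Equiv.addLeft m).tsum_eq (fun n : ℤ => H (z - (ε * n : ℝ)))]
    congr 1; ext n
    simp only [Equiv.coe_addLeft]
    congr 1
    push_cast; ring
  have hΦd : DifferentiableOn ℂ Φ (strip ρ) :=
    (differentiableOn_tsum_translates hσ0 hAA hε hε1 hHd hHB).mono hsub
  refine ⟨ε, hε, hε1, fun z => ψc z / Φ z, A2 / (‖c‖ / 2), by positivity,
    (hψcd.mono hsub).div hΦd hΦ0, fun z hz => ?_, fun z hz => ?_⟩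
  · rw [norm_div]
    calc _ ≤ A2 / (1 + z.re ^ 2) ^ 2 / (‖c‖ / 2) := by
          gcongr
          exacts [hψcA z (hsub hz), hΦn z hz]
      _ = _ := by ring
  · have h1 := (summable_translates hσ0 hAA hε hε1 hHB (hsub hz)).hasSum.div_const (Φ z)
    rw [show (∑' n : ℤ, H (z - (ε * n : ℝ))) = Φ z from rfl, div_self (hΦ0 z hz)] at h1
    refine h1.congr_fun fun n => ?_
    simp only [hper, hH]
    ring

/-! ### Growth of admissible weights -/

theorem AdmissibleWeight.pos (v : AdmissibleWeight) (s : ℝ) : 0 < v s :=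
  one_pos.trans_le (v.one_le s)

theorem AdmissibleWeight.exists_const (v : AdmissibleWeight) :
    ∃ M : ℝ, 1 ≤ M ∧ ∀ s t, v (s + t) ≤ M * (v s + v t) := by
  obtain ⟨M, hM⟩ := v.quasiSubadditive
  refine ⟨max 1 M, le_max_left _ _, fun s t => (hM s t).trans ?_⟩
  exact mul_le_mul_of_nonneg_right (le_max_right _ _) (add_pos (v.pos s) (v.pos t)).le

/-- Steinhaus argument: the symmetric sets where `v` is at most `n` exhaust `ℝ`, so one has positive
measure and its difference set contains a neighbourhood of `0`. -/
theorem AdmissibleWeight.exists_bound_near_zero (v : AdmissibleWeight) :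
    ∃ r : ℝ, 0 < r ∧ ∃ K : ℝ, ∀ s, |s| < r → v s ≤ K := by
  obtain ⟨M, hM1, hM⟩ := v.exists_const
  set E : ℕ → Set ℝ := fun n => {s | v s ≤ n ∧ v (-s) ≤ n} with hE
  have hEm : ∀ n, MeasurableSet (E n) := fun n =>
    (measurableSet_le v.measurable measurable_const).inter
      (measurableSet_le (v.measurable.comp measurable_neg) measurable_const)
  have hU : ⋃ n, E n = Set.univ := by
    refine Set.eq_univ_of_forall fun s => Set.mem_iUnion.2 ?_
    obtain ⟨n, hn⟩ := exists_nat_ge (max (v s) (v (-s)))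
    exact ⟨n, (le_max_left _ _).trans hn, (le_max_right _ _).trans hn⟩
  obtain ⟨n, hn⟩ : ∃ n, 0 < volume (E n) := by
    by_contra! h
    have : volume (⋃ n, E n) = 0 := measure_iUnion_null fun n => le_antisymm (h n) bot_le
    rw [hU] at this
    simp at this
  have hnhds := Measure.sub_mem_nhds_zero_of_addHaar_pos volume (E n) (hEm n) hn
  obtain ⟨r, hr, hball⟩ := Metric.mem_nhds_iff.1 hnhds
  refine ⟨r, hr, M * (n + n), fun s hs => ?_⟩
  obtain ⟨x, hx, y, hy, hxy⟩ := hball (show s ∈ Metric.ball 0 r by simpa using hs)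
  have hs' : s = x + -y := hxy.symm.trans (sub_eq_add_neg x y)
  rw [hs']
  refine (hM x (-y)).trans ?_
  have h1 : v x ≤ n := hx.1
  have h2 : v (-y) ≤ n := hy.2
  gcongr

/-- Holds because `n log q = o(2^n)`. It turns a doubling bound on dyadic scales into an exponential
bound of arbitrarily small rate. -/
theorem exists_pow_le_exp {q c : ℝ} (hq : 1 ≤ q) (hc : 0 < c) :
    ∃ C : ℝ, 0 ≤ C ∧ ∀ n : ℕ, q ^ n ≤ C * Real.exp (c * 2 ^ n) := by
  have h1 : Tendsto (fun n : ℕ => (n : ℝ) ^ 1 / 2 ^ n * Real.log q) atTop (𝓝 0) := by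
    simpa using (tendsto_pow_const_div_const_pow_of_one_lt 1 one_lt_two).mul_const (Real.log q)
  obtain ⟨N, hN⟩ := eventually_atTop.1 (h1.eventually (gt_mem_nhds hc))
  refine ⟨q ^ N, by positivity, fun n => ?_⟩
  have he : 1 ≤ Real.exp (c * 2 ^ n) := Real.one_le_exp (by positivity)
  rcases le_total n N with h | h
  · calc q ^ n ≤ q ^ N := pow_le_pow_right₀ hq h
      _ ≤ _ := le_mul_of_one_le_right (by positivity) he
  · have h2 := (hN n h).le
    have h3 : n * Real.log q ≤ c * 2 ^ n := by
      rw [pow_one, div_mul_eq_mul_div, div_le_iff₀ (by positivity)] at h2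
      exact h2
    calc q ^ n = Real.exp (n * Real.log q) := by
          rw [mul_comm, Real.exp_mul, Real.exp_log (by linarith), Real.rpow_natCast]
      _ ≤ Real.exp (c * 2 ^ n) := Real.exp_le_exp.2 h3
      _ ≤ _ := le_mul_of_one_le_left (by positivity) (one_le_pow₀ hq)

/-- Admissible weights grow subexponentially. -/
theorem AdmissibleWeight.exists_le_exp (v : AdmissibleWeight) {δ : ℝ} (hδ : 0 < δ) :
    ∃ C : ℝ, 0 ≤ C ∧ ∀ s, v s ≤ C * Real.exp (δ * |s|) := by
  obtain ⟨M, hM1, hM⟩ := v.exists_const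
  obtain ⟨r, hr, K, hK⟩ := v.exists_bound_near_zero
  have hK0 : 0 ≤ K := (v.pos 0).le.trans (hK 0 (by simpa using hr))
  -- Quasi-subadditivity at `s/2 + s/2` costs a factor `2M` per doubling.
  have hdbl : ∀ n : ℕ, ∀ s, |s| < 2 ^ n * r → v s ≤ (2 * M) ^ n * K := by
    intro n
    induction n with
    | zero => intro s hs; simpa using hK s (by simpa using hs)
    | succ n ih =>
      intro s hs
      have h1 : |s / 2| < 2 ^ n * r := by
        rw [abs_div, abs_two, div_lt_iff₀ two_pos]
        calc |s| < _ := hs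
          _ = _ := by ring
      have h2 := hM (s / 2) (s / 2)
      rw [add_halves] at h2
      have h3 := ih _ h1
      calc v s ≤ M * (v (s / 2) + v (s / 2)) := h2
        _ ≤ M * ((2 * M) ^ n * K + (2 * M) ^ n * K) := by gcongr
        _ = _ := by ring
  obtain ⟨C, hC, hpow⟩ := exists_pow_le_exp (q := 2 * M) (by linarith) (mul_pos hδ hr)
  refine ⟨2 * M * K * C * Real.exp (δ * r), by positivity, fun s => ?_⟩
  -- `2^n` is comparable to `1 + |s| / r`: the upper neighbour puts `s` in range of the doubling
  -- bound, the lower one bounds the exponential.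
  obtain ⟨n, hn1, hn2⟩ := exists_nat_pow_near (x := 1 + |s| / r) (y := (2 : ℝ))
    (by have := abs_nonneg s; have : 0 ≤ |s| / r := by positivity
        linarith) one_lt_two
  have h1 : |s| < 2 ^ (n + 1) * r := by
    rw [← div_lt_iff₀ hr]; linarith
  have h2 : δ * r * 2 ^ n ≤ δ * r + δ * |s| := by
    calc δ * r * 2 ^ n ≤ δ * r * (1 + |s| / r) := by gcongr
      _ = _ := by field_simp
  calc v s ≤ (2 * M) ^ (n + 1) * K := hdbl _ s h1
    _ = 2 * M * K * (2 * M) ^ n := by ring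
    _ ≤ 2 * M * K * (C * Real.exp (δ * r * 2 ^ n)) := by gcongr; exact hpow n
    _ ≤ 2 * M * K * (C * Real.exp (δ * r + δ * |s|)) := by gcongr
    _ = _ := by rw [Real.exp_add]; ring

/-- The weight `v e^{ω|·|}`. -/
noncomputable def expWeight (v : AdmissibleWeight) (ω s : ℝ) : ℝ := v s * Real.exp (ω * |s|)

theorem exp_le_expWeight (v : AdmissibleWeight) (ω s : ℝ) :
    Real.exp (ω * |s|) ≤ expWeight v ω s :=
  le_mul_of_one_le_left (Real.exp_pos _).le (v.one_le s)

theorem one_le_expWeight (v : AdmissibleWeight) {ω : ℝ} (hω : 0 ≤ ω) (s : ℝ) :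
    1 ≤ expWeight v ω s :=
  (Real.one_le_exp (by positivity)).trans (exp_le_expWeight v ω s)

theorem expWeight_pos (v : AdmissibleWeight) (ω s : ℝ) : 0 < expWeight v ω s :=
  (Real.exp_pos _).trans_le (exp_le_expWeight v ω s)

theorem measurable_expWeight (v : AdmissibleWeight) (ω : ℝ) : Measurable (expWeight v ω) :=
  v.measurable.mul (by fun_prop)

/-- An exponentially decaying kernel is dominated after the weight is moved to the other factor. -/
theorem exists_expWeight_le (v : AdmissibleWeight) {ω a : ℝ} (hω : 0 ≤ ω) (ha : ω < a) :
    ∃ K : ℝ, 0 ≤ K ∧ ∀ s t, expWeight v ω s * Real.exp (-a * |s - t|) ≤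
      K * Real.exp (-((a - ω) / 2) * |s - t|) * expWeight v ω t := by
  obtain ⟨M, hM1, hM⟩ := v.exists_const
  -- Of the surplus decay `a - ω`, one half absorbs the growth of `v (s - t)` and the other half
  -- remains.
  obtain ⟨C, hC, hv⟩ := v.exists_le_exp (δ := (a - ω) / 2) (by linarith)
  refine ⟨2 * M * C, by positivity, fun s t => ?_⟩
  -- Since `v ≥ 1`, a sum of two values is at most twice their product, so `v` is submultiplicative
  -- up to a constant.
  have h1 : v s ≤ 2 * M * (v (s - t) * v t) := by
    have := hM (s - t) t
    rw [sub_add_cancel] at this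
    have h2 : v (s - t) + v t ≤ 2 * (v (s - t) * v t) := by
      nlinarith [v.one_le (s - t), v.one_le t,
        mul_nonneg (sub_nonneg.2 (v.one_le (s - t))) (sub_nonneg.2 (v.one_le t))]
    calc v s ≤ M * (v (s - t) + v t) := this
      _ ≤ M * (2 * (v (s - t) * v t)) := by gcongr
      _ = _ := by ring
  have h3 : Real.exp (ω * |s|) ≤ Real.exp (ω * |s - t|) * Real.exp (ω * |t|) := by
    rw [← Real.exp_add, ← mul_add]
    gcongr
    simpa using abs_add_le (s - t) t
  have hvt := (v.pos t).le
  have hvst := (v.pos (s - t)).le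
  calc expWeight v ω s * Real.exp (-a * |s - t|)
      ≤ 2 * M * (C * Real.exp ((a - ω) / 2 * |s - t|) * v t) *
        (Real.exp (ω * |s - t|) * Real.exp (ω * |t|)) * Real.exp (-a * |s - t|) := by
        unfold expWeight
        gcongr
        exact h1.trans (by gcongr; exact hv _)
    _ = 2 * M * C * (Real.exp ((a - ω) / 2 * |s - t|) * Real.exp (ω * |s - t|) *
        Real.exp (-a * |s - t|)) * (v t * Real.exp (ω * |t|)) := by ring
    _ = _ := by
        rw [← Real.exp_add, ← Real.exp_add, expWeight]
        congr 3
        ring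

/-! ### Convolution with exponentially decaying kernels -/

theorem integrable_exp_neg_abs {δ : ℝ} (hδ : 0 < δ) :
    Integrable fun s : ℝ => Real.exp (-δ * |s|) := by
  have h := ((integrable_decay 2 0).comp_mul_left' hδ.ne')
  refine h.mono' (by fun_prop) (ae_of_all _ fun s => ?_)
  rw [Real.norm_eq_abs, abs_of_pos (Real.exp_pos _), neg_mul, Real.exp_neg, sub_zero,
    inv_le_comm₀ (Real.exp_pos _) (by positivity), inv_div]
  have h1 := Real.quadratic_le_exp_of_nonneg (x := δ * |s|) (by positivity)
  have h2 : 0 ≤ δ * |s| := by positivity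
  have h3 : (δ * |s|) ^ 2 = (δ * s) ^ 2 := by rw [mul_pow, sq_abs, mul_pow]
  linarith

theorem lintegral_exp_neg_abs_lt_top {δ : ℝ} (hδ : 0 < δ) :
    ∫⁻ s : ℝ, ENNReal.ofReal (Real.exp (-δ * |s|)) < ∞ := by
  have h := (integrable_exp_neg_abs hδ).hasFiniteIntegral
  rw [hasFiniteIntegral_iff_ofReal (ae_of_all _ fun s => (Real.exp_pos _).le)] at h
  exact h

theorem memLp_two_exp_neg_abs {δ : ℝ} (hδ : 0 < δ) :
    MemLp (fun s : ℝ => Real.exp (-δ * |s|)) 2 := by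
  refine (memLp_two_iff_integrable_sq (by fun_prop)).2 ?_
  have h := integrable_exp_neg_abs (δ := 2 * δ) (by positivity)
  refine h.congr (ae_of_all _ fun s => ?_)
  simp only
  rw [sq, ← Real.exp_add]
  congr 1
  ring

/-- Young's inequality `L¹ * L² ⊆ L²` for nonnegative functions. -/
theorem lintegral_conv_sq_le {E u : ℝ → ℝ≥0∞} (hE : Measurable E) (hu : Measurable u) :
    ∫⁻ s, (∫⁻ t, E (s - t) * u t) ^ 2 ≤ (∫⁻ t, E t) ^ 2 * ∫⁻ t, u t ^ 2 := by
  have h2 : ∀ x : ℝ≥0∞, (x ^ (1 / 2 : ℝ)) ^ (2 : ℝ) = x := fun x => by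
    rw [← ENNReal.rpow_mul]; norm_num
  have hEs : ∀ s, Measurable fun t => E (s - t) := fun s => hE.comp (measurable_const.sub measurable_id)
  -- Cauchy–Schwarz after splitting the kernel as `E^{1/2} E^{1/2}`; Tonelli then finishes.
  have hcs : ∀ s, (∫⁻ t, E (s - t) * u t) ^ 2 ≤ (∫⁻ t, E t) * ∫⁻ t, E (s - t) * u t ^ 2 := by
    intro s
    have h := ENNReal.lintegral_mul_le_Lp_mul_Lq volume Real.HolderConjugate.two_two
      (f := fun t => E (s - t) ^ (1 / 2 : ℝ)) (g := fun t => E (s - t) ^ (1 / 2 : ℝ) * u t)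
      ((hEs s).pow_const _).aemeasurable (((hEs s).pow_const _).mul hu).aemeasurable
    simp only [Pi.mul_apply, ENNReal.mul_rpow_of_nonneg _ _ zero_le_two, h2, ← mul_assoc] at h
    simp only [← ENNReal.rpow_add_of_nonneg _ _ (show (0 : ℝ) ≤ 1 / 2 by norm_num)
      (show (0 : ℝ) ≤ 1 / 2 by norm_num), add_halves, ENNReal.rpow_one, ENNReal.rpow_two] at h
    rw [lintegral_sub_left_eq_self E s] at h
    calc _ ≤ _ := pow_le_pow_left₀ bot_le h 2
      _ = _ := by
        rw [mul_pow, ← ENNReal.rpow_two, h2, ← ENNReal.rpow_two, h2]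
  calc ∫⁻ s, (∫⁻ t, E (s - t) * u t) ^ 2
      ≤ ∫⁻ s, (∫⁻ t, E t) * ∫⁻ t, E (s - t) * u t ^ 2 := lintegral_mono hcs
    _ = (∫⁻ t, E t) * ∫⁻ s, ∫⁻ t, E (s - t) * u t ^ 2 := by
        rw [lintegral_const_mul]
        refine Measurable.lintegral_prod_right' (f := fun p : ℝ × ℝ => E (p.1 - p.2) * u p.2 ^ 2) ?_
        exact (hE.comp (measurable_fst.sub measurable_snd)).mul
          ((hu.comp measurable_snd).pow_const 2)
    _ = (∫⁻ t, E t) * ∫⁻ t, ∫⁻ s, E (s - t) * u t ^ 2 := by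
        rw [lintegral_lintegral_swap]
        exact ((hE.comp (measurable_fst.sub measurable_snd)).mul
          ((hu.comp measurable_snd).pow_const 2)).aemeasurable
    _ = (∫⁻ t, E t) * ∫⁻ t, (∫⁻ s, E s) * u t ^ 2 := by
        congr 1
        refine lintegral_congr fun t => ?_
        rw [lintegral_mul_const _ (show Measurable fun s => E (s - t) from
          hE.comp (measurable_id.sub measurable_const))]
        congr 1
        exact lintegral_sub_right_eq_self E t
    _ = _ := by
        rw [lintegral_const_mul _ (hu.pow_const 2), sq, mul_assoc]

theorem norm_conv_integrand_le {k g : ℝ → ℂ} {B a : ℝ}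
    (hkB : ∀ s, ‖k s‖ ≤ B * Real.exp (-a * |s|)) (s t : ℝ) :
    ‖k (s - t) * g t‖ ≤ B * Real.exp (-a * |s - t|) * ‖g t‖ := by
  rw [norm_mul]
  exact mul_le_mul_of_nonneg_right (hkB _) (norm_nonneg _)

theorem integrable_exp_mul_of_memLp {g : ℝ → ℂ} (hg2 : MemLp g 2) {a : ℝ} (ha : 0 < a)
    (C s : ℝ) : Integrable fun t => C * Real.exp (-a * |s - t|) * ‖g t‖ := by
  have h := ((memLp_two_exp_neg_abs ha).comp_measurePreserving
    (Measure.measurePreserving_sub_left volume s)).integrable_mul hg2.norm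
  refine (h.const_mul C).congr (ae_of_all _ fun t => ?_)
  simp [mul_assoc]

theorem integrable_conv {k g : ℝ → ℂ} {B a : ℝ} (ha : 0 < a) (hk : Continuous k)
    (hkB : ∀ s, ‖k s‖ ≤ B * Real.exp (-a * |s|)) (hg2 : MemLp g 2) (s : ℝ) :
    Integrable fun t => k (s - t) * g t := by
  refine (integrable_exp_mul_of_memLp hg2 ha B s).mono' ?_
    (ae_of_all _ fun t => norm_conv_integrand_le hkB s t)
  exact (hk.comp (continuous_const.sub continuous_id)).aestronglyMeasurable.mul hg2.1

/-- Dominated convergence: for `|s - s₀| < 1` the exponential kernel changes by at most the factor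
`e^a`. -/
theorem continuous_conv {k g : ℝ → ℂ} {B a : ℝ} (ha : 0 < a) (hB : 0 ≤ B) (hk : Continuous k)
    (hkB : ∀ s, ‖k s‖ ≤ B * Real.exp (-a * |s|)) (hg2 : MemLp g 2) :
    Continuous fun s => ∫ t, k (s - t) * g t := by
  refine continuous_iff_continuousAt.2 fun s₀ => ?_
  refine continuousAt_of_dominated
    (bound := fun t => B * Real.exp a * Real.exp (-a * |s₀ - t|) * ‖g t‖)
    (Eventually.of_forall fun s => (integrable_conv ha hk hkB hg2 s).1) ?_
    (integrable_exp_mul_of_memLp hg2 ha (B * Real.exp a) s₀)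
    (ae_of_all _ fun t => by fun_prop)
  filter_upwards [Metric.ball_mem_nhds s₀ one_pos] with s hs
  refine ae_of_all _ fun t => (norm_conv_integrand_le hkB s t).trans ?_
  refine mul_le_mul_of_nonneg_right ?_ (norm_nonneg _)
  rw [mul_assoc, ← Real.exp_add]
  gcongr
  have h1 : |s₀ - t| ≤ |s - t| + 1 := by
    have h2 := abs_sub_le s₀ s t
    have h3 : |s₀ - s| < 1 := by
      rw [abs_sub_comm]; simpa [Real.dist_eq] using hs
    linarith
  nlinarith

/-- Weighted estimates for the convolution of an exponentially decaying kernel with an element of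
the weighted `L²` space. -/
theorem exists_conv_bound (v : AdmissibleWeight) {ω a : ℝ} (hω : 0 ≤ ω) (ha : ω < a) :
    ∃ K : ℝ, 0 ≤ K ∧ ∀ (k g : ℝ → ℂ) (B : ℝ), 0 ≤ B → (∀ s, ‖k s‖ ≤ B * Real.exp (-a * |s|)) →
      Measurable g → MemLp (fun s => (expWeight v ω s : ℂ) * g s) 2 →
      (∀ s, expWeight v ω s * ‖∫ t, k (s - t) * g t‖ ≤
        K * B * (eLpNorm (fun s => (expWeight v ω s : ℂ) * g s) 2).toReal) ∧
      eLpNorm (fun s => (expWeight v ω s : ℂ) * ∫ t, k (s - t) * g t) 2 ≤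
        ENNReal.ofReal (K * B) * eLpNorm (fun s => (expWeight v ω s : ℂ) * g s) 2 := by
  obtain ⟨K₁, hK₁, hw⟩ := exists_expWeight_le v hω ha
  set δ := (a - ω) / 2 with hδd
  have hδ : 0 < δ := by simp only [hδd]; linarith
  set E : ℝ → ℝ≥0∞ := fun s => ENNReal.ofReal (Real.exp (-δ * |s|)) with hE
  have hEm : Measurable E := by fun_prop
  set I1 := ∫⁻ s, E s
  have hI1 : I1 ≠ ∞ := (lintegral_exp_neg_abs_lt_top hδ).ne
  set I2 := eLpNorm E 2
  have hI2 : I2 ≠ ∞ := by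
    have h := (memLp_two_exp_neg_abs hδ).2.ne
    convert h using 1
    refine eLpNorm_congr_enorm_ae (ae_of_all _ fun s => ?_)
    simp only [hE, enorm_eq_self]
    rw [Real.enorm_eq_ofReal (Real.exp_pos _).le]
  refine ⟨K₁ * (I1.toReal + I2.toReal), by positivity, fun k g B hB hkB hgm hU => ?_⟩
  set U : ℝ → ℂ := fun s => (expWeight v ω s : ℂ) * g s with hUd
  have hUm : Measurable U := (measurable_expWeight v ω).complex_ofReal.mul hgm
  -- The weight passes onto `g`, leaving an unweighted convolution `E * |U|`. Cauchy–Schwarz with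
  -- `I2` then gives the sup bound, Young with `I1` the `L²` bound.
  have hpt : ∀ s, ‖(expWeight v ω s : ℂ) * ∫ t, k (s - t) * g t‖ₑ ≤
      ENNReal.ofReal (K₁ * B) * ∫⁻ t, E (s - t) * ‖U t‖ₑ := by
    intro s
    rw [← integral_const_mul, ← lintegral_const_mul _ (by fun_prop)]
    refine (enorm_integral_le_lintegral_enorm _).trans (lintegral_mono fun t => ?_)
    rw [← ofReal_norm, ← ofReal_norm, hE,
      ← ENNReal.ofReal_mul (Real.exp_pos _).le, ← ENNReal.ofReal_mul (by positivity)]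
    refine ENNReal.ofReal_le_ofReal ?_
    have hws := (expWeight_pos v ω s).le
    have hwt := (expWeight_pos v ω t).le
    have hUt : ‖U t‖ = expWeight v ω t * ‖g t‖ := by
      rw [hUd]
      simp only [norm_mul, Complex.norm_real, Real.norm_eq_abs, abs_of_nonneg hwt]
    rw [hUt, norm_mul _ (k (s - t) * g t), Complex.norm_real, Real.norm_eq_abs, abs_of_nonneg hws]
    calc expWeight v ω s * ‖k (s - t) * g t‖
        ≤ expWeight v ω s * (B * Real.exp (-a * |s - t|) * ‖g t‖) := by
          gcongr; exact norm_conv_integrand_le hkB s t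
      _ = B * (expWeight v ω s * Real.exp (-a * |s - t|)) * ‖g t‖ := by ring
      _ ≤ B * (K₁ * Real.exp (-δ * |s - t|) * expWeight v ω t) * ‖g t‖ := by
          exact mul_le_mul_of_nonneg_right (mul_le_mul_of_nonneg_left (hw s t) hB) (norm_nonneg _)
      _ = _ := by ring
  have hI1' : I1 ≤ ENNReal.ofReal (I1.toReal + I2.toReal) := by
    rw [← ENNReal.ofReal_toReal hI1, ENNReal.toReal_ofReal ENNReal.toReal_nonneg]
    exact ENNReal.ofReal_le_ofReal (le_add_of_nonneg_right ENNReal.toReal_nonneg)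
  have hI2' : I2 ≤ ENNReal.ofReal (I1.toReal + I2.toReal) := by
    rw [← ENNReal.ofReal_toReal hI2, ENNReal.toReal_ofReal ENNReal.toReal_nonneg]
    exact ENNReal.ofReal_le_ofReal (le_add_of_nonneg_left ENNReal.toReal_nonneg)
  have hcst : ENNReal.ofReal (K₁ * (I1.toReal + I2.toReal) * B) =
      ENNReal.ofReal (K₁ * B) * ENNReal.ofReal (I1.toReal + I2.toReal) := by
    rw [← ENNReal.ofReal_mul (by positivity)]
    congr 1; ring
  have hL2 : ∀ f : ℝ → ℝ≥0∞, eLpNorm f 2 = (∫⁻ s, f s ^ 2) ^ (1 / 2 : ℝ) := fun f => by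
    rw [eLpNorm_eq_lintegral_rpow_enorm_toReal two_ne_zero ENNReal.ofNat_ne_top]
    simp
  have hUe : eLpNorm U 2 = eLpNorm (fun t => ‖U t‖ₑ) 2 :=
    eLpNorm_congr_enorm_ae (ae_of_all _ fun s => by simp)
  have haux : ∀ x y J : ℝ≥0∞, (x ^ 2 * (y ^ 2 * J)) ^ (1 / 2 : ℝ) = x * y * J ^ (1 / 2 : ℝ) := by
    intro x y J
    have h2 : ∀ x : ℝ≥0∞, (x ^ 2) ^ (1 / 2 : ℝ) = x := fun x => by
      rw [← ENNReal.rpow_two, ← ENNReal.rpow_mul]; norm_num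
    rw [ENNReal.mul_rpow_of_nonneg _ _ (by norm_num),
      ENNReal.mul_rpow_of_nonneg _ _ (by norm_num), h2, h2, mul_assoc]
  constructor
  · intro s
    have hh : ∫⁻ t, E (s - t) * ‖U t‖ₑ ≤ I2 * eLpNorm U 2 := by
      have h := ENNReal.lintegral_mul_le_Lp_mul_Lq volume Real.HolderConjugate.two_two
        (f := fun t => E (s - t)) (g := fun t => ‖U t‖ₑ)
        (hEm.comp (measurable_const.sub measurable_id)).aemeasurable hUm.enorm.aemeasurable
      simp only [Pi.mul_apply, ENNReal.rpow_two] at h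
      rw [lintegral_sub_left_eq_self (fun t => E t ^ 2) s, ← hL2, ← hL2, ← hUe] at h
      exact h
    have h1 : ‖(expWeight v ω s : ℂ) * ∫ t, k (s - t) * g t‖ₑ ≤
        ENNReal.ofReal (K₁ * (I1.toReal + I2.toReal) * B) * eLpNorm U 2 := by
      refine (hpt s).trans ?_
      rw [hcst, mul_assoc]
      gcongr
      exact hh.trans (by gcongr)
    have h2 := ENNReal.toReal_mono (ENNReal.mul_ne_top ENNReal.ofReal_ne_top hU.2.ne) h1
    rw [toReal_enorm, norm_mul, Complex.norm_real, Real.norm_eq_abs,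
      abs_of_pos (expWeight_pos v ω s), ENNReal.toReal_mul,
      ENNReal.toReal_ofReal (by positivity)] at h2
    exact h2
  · rw [eLpNorm_eq_lintegral_rpow_enorm_toReal two_ne_zero ENNReal.ofNat_ne_top, hUe, hL2, hcst]
    simp only [ENNReal.toReal_ofNat, ENNReal.rpow_two]
    have h1 : ∫⁻ s, ‖(expWeight v ω s : ℂ) * ∫ t, k (s - t) * g t‖ₑ ^ 2 ≤
        ENNReal.ofReal (K₁ * B) ^ 2 * (I1 ^ 2 * ∫⁻ t, ‖U t‖ₑ ^ 2) := by
      have h2 : ∫⁻ s, ‖(expWeight v ω s : ℂ) * ∫ t, k (s - t) * g t‖ₑ ^ 2 ≤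
          ∫⁻ s, (ENNReal.ofReal (K₁ * B)) ^ 2 * (∫⁻ t, E (s - t) * ‖U t‖ₑ) ^ 2 := by
        refine lintegral_mono fun s => ?_
        rw [← mul_pow]
        exact pow_le_pow_left₀ bot_le (hpt s) 2
      rw [lintegral_const_mul' _ _ (by simp)] at h2
      exact h2.trans (mul_le_mul_right (lintegral_conv_sq_le hEm hUm.enorm) _)
    refine (ENNReal.rpow_le_rpow h1 (by norm_num)).trans ?_
    rw [haux]
    gcongr

/-! ### Inverse Fourier transforms -/

/-- The inverse Fourier integral `(2π)⁻¹ ∫ f x e^{isx} dx`. -/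
noncomputable def invIntegral (f : ℝ → ℂ) (s : ℝ) : ℂ :=
  (2 * (Real.pi : ℂ))⁻¹ * ∫ x : ℝ, f x * Complex.exp (Complex.I * s * x)

theorem fourierInv_eq_integral (f : ℝ → ℂ) (w : ℝ) :
    𝓕⁻ f w = ∫ x : ℝ, f x * Complex.exp (Complex.I * (2 * Real.pi * w : ℝ) * x) := by
  rw [Real.fourierInv_eq']
  refine integral_congr_ae (ae_of_all _ fun x => ?_)
  simp only [smul_eq_mul, RCLike.inner_apply, conj_trivial]
  rw [mul_comm]
  congr 2
  push_cast; ring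

theorem invIntegral_eq (f : ℝ → ℂ) (s : ℝ) :
    invIntegral f s = (2 * (Real.pi : ℂ))⁻¹ * 𝓕⁻ f (s / (2 * Real.pi)) := by
  rw [fourierInv_eq_integral, mul_div_cancel₀ _ (by positivity : 2 * Real.pi ≠ 0), invIntegral]

theorem continuous_fourierInv {f : ℝ → ℂ} (hf : Integrable f) : Continuous (𝓕⁻ f) :=
  VectorFourier.fourierIntegral_continuous Real.continuous_fourierChar
    (by fun_prop) hf

theorem continuous_invIntegral {f : ℝ → ℂ} (hf : Integrable f) : Continuous (invIntegral f) := by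
  have : invIntegral f = fun s => (2 * (Real.pi : ℂ))⁻¹ * 𝓕⁻ f (s / (2 * Real.pi)) :=
    funext (invIntegral_eq f)
  rw [this]
  have := continuous_fourierInv hf
  fun_prop

theorem norm_exp_I_mul (s : ℝ) (z : ℂ) :
    ‖Complex.exp (Complex.I * s * z)‖ = Real.exp (-s * z.im) := by
  rw [Complex.norm_exp]
  congr 1
  simp

theorem norm_invIntegral_le (f : ℝ → ℂ) (s : ℝ) :
    ‖invIntegral f s‖ ≤ (2 * Real.pi)⁻¹ * ∫ x : ℝ, ‖f x‖ := by
  rw [invIntegral, norm_mul]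
  have h1 : ‖(2 * (Real.pi : ℂ))⁻¹‖ = (2 * Real.pi)⁻¹ := by
    rw [norm_inv, norm_mul, Complex.norm_real, Real.norm_eq_abs, abs_of_pos Real.pi_pos]
    simp
  rw [h1]
  gcongr
  refine (norm_integral_le_integral_norm _).trans_eq ?_
  refine integral_congr_ae (ae_of_all _ fun x => ?_)
  simp [norm_exp_I_mul]

/-- Fourier inversion. -/
theorem eq_integral_invIntegral {f : ℝ → ℂ} (hf : Integrable f) (hc : Continuous f)
    (hi : Integrable (invIntegral f)) (x : ℝ) :
    f x = ∫ s : ℝ, invIntegral f s * Complex.exp (-Complex.I * s * x) := by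
  have h2π : 2 * Real.pi ≠ 0 := by positivity
  have hF : ∀ w, 𝓕⁻ f w = 2 * (Real.pi : ℂ) * invIntegral f (2 * Real.pi * w) := fun w => by
    rw [invIntegral_eq, mul_div_cancel_left₀ _ h2π, mul_inv_cancel_left₀]
    exact_mod_cast h2π
  have hFi : Integrable (𝓕⁻ f) := by
    simp only [funext hF]
    exact (hi.comp_mul_left' h2π).const_mul _
  have hFi' : Integrable (𝓕 f) := by
    refine hFi.comp_neg.congr (ae_of_all _ fun w => ?_)
    simp only
    rw [Real.fourierInv_eq_fourier_neg, neg_neg]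
  have h := hf.fourier_fourierInv_eq hFi' (v := x) hc.continuousAt
  rw [← h, Real.fourier_eq']
  have h3 := Measure.integral_comp_mul_left
    (fun s : ℝ => invIntegral f s * Complex.exp (-Complex.I * s * x)) (2 * Real.pi)
  rw [abs_of_pos (by positivity)] at h3
  have h4 : ∫ s : ℝ, invIntegral f s * Complex.exp (-Complex.I * s * x) =
      (2 * Real.pi : ℂ) * ((2 * Real.pi)⁻¹ • ∫ s : ℝ, invIntegral f s *
        Complex.exp (-Complex.I * s * x)) := by
    rw [Complex.real_smul, ← mul_assoc]
    push_cast
    rw [mul_inv_cancel₀ (by exact_mod_cast h2π), one_mul]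
  rw [h4, ← h3, ← integral_const_mul]
  refine integral_congr_ae (ae_of_all _ fun w => ?_)
  simp only [smul_eq_mul, hF, RCLike.inner_apply, conj_trivial]
  rw [mul_comm, mul_assoc]
  congr 3
  push_cast; ring

/-- On `L¹ ∩ L²`, the inverse Fourier transform of Plancherel is the inverse Fourier integral. -/
theorem fourierInv_Lp_ae_eq (F : Lp ℂ 2 (volume : Measure ℝ)) (hF : Integrable F) :
    (𝓕⁻ F : Lp ℂ 2 (volume : Measure ℝ)) =ᵐ[volume] 𝓕⁻ (F : ℝ → ℂ) := by
  refine ae_eq_of_integral_contDiff_smul_eq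
    ((Lp.memLp _).locallyIntegrable (by norm_num))
    (continuous_fourierInv hF).locallyIntegrable fun g hg hgc => ?_
  have hg₁ : HasCompactSupport (Complex.ofRealCLM ∘ g) := hgc.comp_left rfl
  have hg₂ : ContDiff ℝ ((⊤ : ℕ∞) : WithTop ℕ∞) (Complex.ofRealCLM ∘ g) := by fun_prop
  set u := hg₁.toSchwartzMap hg₂ with hu
  have hug : ∀ x, u x = (g x : ℂ) := fun x => rfl
  have h1 := congrArg (fun T => T u) (Lp.fourierInv_toTemperedDistribution_eq F)
  simp only [TemperedDistribution.fourierInv_apply, Lp.toTemperedDistribution_apply,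
    SchwartzMap.fourierInv_coe] at h1
  -- The multiplication formula moves the transform from the test function to `F`; the flip is
  -- harmless as the pairing is symmetric.
  have h2 : ∫ x, (𝓕⁻ (u : ℝ → ℂ)) x • F x = ∫ x, u x • 𝓕⁻ (F : ℝ → ℂ) x := by
    have h := VectorFourier.integral_fourierIntegral_smul_eq_flip (L := -innerₗ ℝ)
      (μ := volume) (ν := volume) Real.continuous_fourierChar (by fun_prop) u.integrable hF
    have hflip : (-innerₗ ℝ : ℝ →ₗ[ℝ] ℝ →ₗ[ℝ] ℝ).flip = -innerₗ ℝ := by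
      ext; simp
    rw [hflip] at h
    exact h
  rw [h2] at h1
  simpa [hug] using h1.symm

open ComplexConjugate in
/-- The inverse Fourier transform of a product is a convolution. -/
theorem invFourier_mul_ae_eq {m : ℝ → ℂ} (hm1 : Integrable m) (hm2 : MemLp m 2)
    (F P : Lp ℂ 2 (volume : Measure ℝ)) (hP : P =ᵐ[volume] fun x => m x * F x) :
    invFourier P =ᵐ[volume] fun s => ∫ t, invIntegral m (s - t) * invFourier F t := by
  have h2π : 2 * Real.pi ≠ 0 := by positivity
  have hPi : Integrable P := (hm2.integrable_mul (Lp.memLp F)).congr hP.symm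
  filter_upwards [ae_dilate (fourierInv_Lp_ae_eq P hPi)] with s hs
  -- Parseval for `⟨q, F⟩` with this `q`: one side is the inverse transform of `m F` at `s`, the
  -- other the convolution integral at `s`.
  set q : ℝ → ℂ := fun x => conj (m x * Complex.exp (Complex.I * s * x)) with hq
  have hqc : AEStronglyMeasurable (fun x : ℝ => Complex.exp (Complex.I * s * x)) :=
    Continuous.aestronglyMeasurable (by fun_prop)
  have hqm : AEStronglyMeasurable q :=
    Complex.continuous_conj.comp_aestronglyMeasurable (hm1.1.mul hqc)
  have hqn : ∀ x, ‖q x‖ = ‖m x‖ := fun x => by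
    simp [hq, norm_exp_I_mul]
  have hq1 : Integrable q := hm1.congr' hqm (ae_of_all _ fun x => (hqn x).symm)
  have hq2 : MemLp q 2 := hm2.congr_norm hqm (ae_of_all _ fun x => (hqn x).symm)
  set Q : Lp ℂ 2 (volume : Measure ℝ) := hq2.toLp q
  have hQq : Q =ᵐ[volume] q := hq2.coeFn_toLp
  have hQ := fourierInv_Lp_ae_eq Q (hq1.congr hQq.symm)
  have hQ' : ∀ w, 𝓕⁻ (Q : ℝ → ℂ) w = conj (2 * Real.pi * invIntegral m (s - 2 * Real.pi * w)) := by
    intro w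
    rw [fourierInv_eq_integral, invIntegral, mul_inv_cancel_left₀ (by exact_mod_cast h2π),
      ← integral_conj]
    refine integral_congr_ae ?_
    filter_upwards [hQq] with x hx
    rw [hx]
    simp only [hq, map_mul, ← Complex.exp_conj, mul_assoc, ← Complex.exp_add, Complex.conj_I,
      Complex.conj_ofReal]
    congr 2
    push_cast; ring
  have hinner : inner ℂ Q F = inner ℂ (𝓕⁻ Q : Lp ℂ 2 (volume : Measure ℝ)) (𝓕⁻ F) :=
    ((Lp.fourierTransformₗᵢ ℝ ℂ).symm.inner_map_map Q F).symm
  rw [L2.inner_def, L2.inner_def] at hinner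
  have hl : ∫ x, inner ℂ (Q x) (F x) = 𝓕⁻ (P : ℝ → ℂ) (s / (2 * Real.pi)) := by
    rw [fourierInv_eq_integral, mul_div_cancel₀ _ h2π]
    refine integral_congr_ae ?_
    filter_upwards [hQq, hP] with x hx hx'
    rw [hx, hx']
    simp only [hq, RCLike.inner_apply, Complex.conj_conj]
    ring
  have hr : ∫ w, inner ℂ ((𝓕⁻ Q : Lp ℂ 2 (volume : Measure ℝ)) w)
      ((𝓕⁻ F : Lp ℂ 2 (volume : Measure ℝ)) w) = ∫ w, (2 * Real.pi * invIntegral m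
        (s - 2 * Real.pi * w)) * (𝓕⁻ F : Lp ℂ 2 (volume : Measure ℝ)) w := by
    refine integral_congr_ae ?_
    filter_upwards [hQ] with w hw
    rw [hw, hQ']
    simp only [RCLike.inner_apply, Complex.conj_conj]
    ring
  rw [hl, hr] at hinner
  have hcv := Measure.integral_comp_mul_left
    (fun t => invIntegral m (s - t) * invFourier F t) (2 * Real.pi)
  rw [abs_of_pos (by positivity), Complex.real_smul] at hcv
  have h2 : (2 * (Real.pi : ℂ)) ≠ 0 := by exact_mod_cast h2π
  have h3 : ∫ t, invIntegral m (s - t) * invFourier F t = 2 * (Real.pi : ℂ) *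
      ∫ w, invIntegral m (s - 2 * Real.pi * w) * invFourier F (2 * Real.pi * w) := by
    rw [hcv, ← mul_assoc]
    push_cast
    rw [mul_inv_cancel₀ h2, one_mul]
  rw [h3, invFourier, hs, hinner, ← integral_const_mul, ← integral_const_mul]
  refine integral_congr_ae (ae_of_all _ fun w => ?_)
  simp only [invFourier, mul_div_cancel_left₀ _ h2π]
  field_simp

/-! ### Kernels of holomorphic multipliers on a strip -/

/-- Contour shift for `m(z) e^{isz}`; at height `y` the exponential contributes the factor
`e^{-sy}`. -/
theorem invIntegral_horizontal {m : ℂ → ℂ} {ρ B b y : ℝ} (hd : DifferentiableOn ℂ m (strip ρ))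
    (hB : ∀ z ∈ strip ρ, ‖m z‖ ≤ B / (1 + (z.re - b) ^ 2)) (hy : |y| < ρ) (s : ℝ) :
    invIntegral (fun x => m (x + y * Complex.I)) s =
      Real.exp (s * y) * invIntegral (fun x => m x) s := by
  have hρ : 0 < ρ := (abs_nonneg y).trans_lt hy
  have hB0 : 0 ≤ B := by
    have := (norm_nonneg _).trans (hB b (ofReal_mem_strip hρ.le b))
    simpa using this
  have h := integral_horizontal_eq (H := fun z => m z * Complex.exp (Complex.I * s * z))
    (B := B * Real.exp (|s| * |y|)) (b := b) (y := y)
    (hd.mul (by fun_prop)) (fun z hz hzy => by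
      rw [norm_mul, norm_exp_I_mul, mul_div_right_comm]
      refine mul_le_mul (hB z hz) (Real.exp_le_exp.2 ?_) (Real.exp_pos _).le
        ((norm_nonneg _).trans (hB z hz))
      calc -s * z.im ≤ |-s * z.im| := le_abs_self _
        _ = |s| * |z.im| := by rw [abs_mul, abs_neg]
        _ ≤ |s| * |y| := by gcongr) hy
  simp only [invIntegral]
  rw [← h, mul_left_comm]
  congr 1
  rw [← integral_const_mul]
  refine integral_congr_ae (ae_of_all _ fun x => ?_)
  simp only
  rw [mul_left_comm, Complex.ofReal_exp, ← Complex.exp_add]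
  congr 2
  push_cast
  linear_combination (-(s : ℂ) * y) * Complex.I_sq

/-- Shift to height `a` or `-a` according to the sign of `s`. The `L¹` norm on each line is at most
`Bπ` whatever `b` is; uniformity over translates rests on this. -/
theorem norm_invIntegral_le_exp {m : ℂ → ℂ} {ρ B b a : ℝ} (hd : DifferentiableOn ℂ m (strip ρ))
    (hB : ∀ z ∈ strip ρ, ‖m z‖ ≤ B / (1 + (z.re - b) ^ 2)) (ha0 : 0 ≤ a) (ha : a < ρ) (s : ℝ) :
    ‖invIntegral (fun x => m x) s‖ ≤ B * Real.exp (-a * |s|) := by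
  have hρ : 0 < ρ := ha0.trans_lt ha
  have hB0 : 0 ≤ B := by
    have := (norm_nonneg _).trans (hB b (ofReal_mem_strip hρ.le b))
    simpa using this
  have key : ∀ y : ℝ, |y| < ρ → Real.exp (s * y) * ‖invIntegral (fun x => m x) s‖ ≤ B := by
    intro y hy
    have h1 := norm_invIntegral_le (fun x => m (x + y * Complex.I)) s
    rw [invIntegral_horizontal hd hB hy, norm_mul, Complex.norm_real, Real.norm_eq_abs,
      abs_of_pos (Real.exp_pos _)] at h1
    refine h1.trans ?_
    have h2 : ∫ x : ℝ, ‖m (x + y * Complex.I)‖ ≤ B * Real.pi := by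
      rw [← integral_decay B b]
      refine integral_mono (integrable_horizontal hd (fun z hz _ => hB z hz) hy).norm
        (integrable_decay B b) fun x => ?_
      have := hB (x + y * Complex.I) ((mem_strip_iff hρ).2 (by simpa using hy))
      simpa using this
    calc (2 * Real.pi)⁻¹ * ∫ x : ℝ, ‖m (x + y * Complex.I)‖
        ≤ (2 * Real.pi)⁻¹ * (B * Real.pi) := by gcongr
      _ = B / 2 := by have := Real.pi_pos; field_simp
      _ ≤ B := by linarith
  have h : Real.exp (a * |s|) * ‖invIntegral (fun x => m x) s‖ ≤ B := by
    rcases le_total 0 s with hs | hs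
    · have := key a (by rwa [abs_of_nonneg ha0])
      rwa [abs_of_nonneg hs, mul_comm a s]
    · have := key (-a) (by rwa [abs_neg, abs_of_nonneg ha0])
      rwa [abs_of_nonpos hs, mul_neg, mul_comm a s, ← mul_neg]
  rw [neg_mul, Real.exp_neg, ← div_eq_mul_inv, le_div_iff₀ (Real.exp_pos _), mul_comm]
  exact h

theorem exp_neg_mul_norm_exp_le {a : ℝ} (s : ℝ) (z : ℂ) :
    Real.exp (-a * |s|) * ‖Complex.exp (-Complex.I * s * z)‖ ≤
      Real.exp (-(a - |z.im|) * |s|) := by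
  have h1 : ‖Complex.exp (-Complex.I * s * z)‖ = Real.exp (s * z.im) := by
    rw [Complex.norm_exp]; congr 1; simp
  rw [h1, ← Real.exp_add]
  gcongr
  have : s * z.im ≤ |s| * |z.im| := by rw [← abs_mul]; exact le_abs_self _
  nlinarith

theorem integrable_mul_exp {k : ℝ → ℂ} {B a : ℝ} (hk : AEStronglyMeasurable k)
    (hkB : ∀ s, ‖k s‖ ≤ B * Real.exp (-a * |s|)) {z : ℂ} (hz : |z.im| < a) :
    Integrable fun s : ℝ => k s * Complex.exp (-Complex.I * s * z) := by
  have hB : 0 ≤ B := by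
    have := (norm_nonneg _).trans (hkB 0)
    simpa using this
  refine ((integrable_exp_neg_abs (sub_pos.2 hz)).const_mul B).mono'
    (hk.mul (Continuous.aestronglyMeasurable (by fun_prop))) (ae_of_all _ fun s => ?_)
  rw [norm_mul]
  calc _ ≤ B * Real.exp (-a * |s|) * ‖Complex.exp (-Complex.I * s * z)‖ := by
        gcongr; exact hkB s
    _ = B * (Real.exp (-a * |s|) * ‖Complex.exp (-Complex.I * s * z)‖) := by ring
    _ ≤ _ := by gcongr; exact exp_neg_mul_norm_exp_le s z

/-- A holomorphic multiplier on a strip is the Fourier transform of its kernel. -/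
theorem eq_integral_kernel {m : ℂ → ℂ} {ρ B b : ℝ} (hd : DifferentiableOn ℂ m (strip ρ))
    (hB : ∀ z ∈ strip ρ, ‖m z‖ ≤ B / (1 + (z.re - b) ^ 2)) {z : ℂ} (hz : |z.im| < ρ) :
    m z = ∫ s : ℝ, invIntegral (fun x => m x) s * Complex.exp (-Complex.I * s * z) := by
  obtain ⟨a, ha1, ha2⟩ := exists_between hz
  have ha0 : 0 ≤ a := (abs_nonneg _).trans ha1.le
  have hi0 : Integrable fun x : ℝ => m x := by
    have := integrable_horizontal (y := 0) hd (fun w hw _ => hB w hw)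
      (by simpa using ha0.trans_lt ha2)
    simpa using this
  -- Fourier inversion is applied on the horizontal line through `z`; the shift supplies the missing
  -- part of the exponent.
  have hshift : ∀ s, invIntegral (fun x => m (x + z.im * Complex.I)) s =
      invIntegral (fun x => m x) s * Complex.exp (-Complex.I * s * (z.im * Complex.I)) := fun s => by
    rw [invIntegral_horizontal hd hB hz, mul_comm, Complex.ofReal_exp]
    congr 2
    push_cast
    linear_combination ((s : ℂ) * z.im) * Complex.I_sq
  have hint := integrable_mul_exp (continuous_invIntegral hi0).aestronglyMeasurable
    (norm_invIntegral_le_exp hd hB ha0 ha2) (z := z.im * Complex.I) (by simpa using ha1)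
  have h := eq_integral_invIntegral (integrable_horizontal hd (fun w hw _ => hB w hw) hz)
    (continuous_horizontal hd hz) (by simpa only [funext hshift] using hint) z.re
  rw [Complex.re_add_im] at h
  rw [h]
  refine integral_congr_ae (ae_of_all _ fun s => ?_)
  simp only
  rw [hshift, mul_assoc, ← Complex.exp_add]
  congr 2
  rw [← mul_add, add_comm, Complex.re_add_im]

/-! ### The Sobolev space of a strip -/

variable {v : AdmissibleWeight} {ω : ℝ}

theorem SobolevStrip.memLp (F : SobolevStrip v ω) :
    MemLp (fun s => (expWeight v ω s : ℂ) * F.inv s) 2 :=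
  Subtype.property (p := (· ∈ sobolevSubmodule v ω)) F

theorem SobolevStrip.coeFn_toWeighted (F : SobolevStrip v ω) :
    SobolevStrip.toWeighted v ω F =ᵐ[volume] fun s => (expWeight v ω s : ℂ) * F.inv s :=
  F.memLp.coeFn_toLp

theorem SobolevStrip.norm_eq (F : SobolevStrip v ω) :
    ‖F‖ = (eLpNorm (fun s => (expWeight v ω s : ℂ) * F.inv s) 2).toReal :=
  Lp.norm_toLp _ F.memLp

theorem measurable_invFourier (F : Lp ℂ 2 (volume : Measure ℝ)) : Measurable (invFourier F) :=
  ((Lp.stronglyMeasurable (𝓕⁻ F : Lp ℂ 2 (volume : Measure ℝ))).measurable.comp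
    (measurable_id.div_const _)).const_mul _

theorem norm_expWeight_mul (v : AdmissibleWeight) (ω s : ℝ) (c : ℂ) :
    ‖(expWeight v ω s : ℂ) * c‖ = expWeight v ω s * ‖c‖ := by
  rw [norm_mul, Complex.norm_real, Real.norm_eq_abs, abs_of_pos (expWeight_pos v ω s)]

theorem SobolevStrip.memLp_inv (hω : 0 ≤ ω) (F : SobolevStrip v ω) : MemLp F.inv 2 := by
  refine F.memLp.mono (measurable_invFourier _).aestronglyMeasurable (ae_of_all _ fun s => ?_)
  rw [norm_expWeight_mul]
  exact le_mul_of_one_le_left (norm_nonneg _) (one_le_expWeight v hω s)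

theorem SobolevStrip.eLpNorm_inv_le (hω : 0 ≤ ω) (F : SobolevStrip v ω) :
    eLpNorm F.inv 2 ≤ ENNReal.ofReal ‖F‖ := by
  rw [F.norm_eq, ENNReal.ofReal_toReal F.memLp.2.ne]
  refine eLpNorm_mono fun s => ?_
  rw [norm_expWeight_mul]
  exact le_mul_of_one_le_left (norm_nonneg _) (one_le_expWeight v hω s)

theorem eLpNorm_comp_two_pi_mul (f : ℝ → ℂ) (hf : AEStronglyMeasurable f) :
    eLpNorm (fun x => f (2 * Real.pi * x)) 2 ≤ eLpNorm f 2 := by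
  have h2π : (2 * Real.pi) ≠ 0 := by positivity
  have hmap := Real.map_volume_mul_left h2π
  have hc : ENNReal.ofReal |(2 * Real.pi)⁻¹| ≤ 1 := by
    rw [ENNReal.ofReal_le_one, abs_of_pos (by positivity)]
    exact inv_le_one_of_one_le₀ (by linarith [Real.pi_gt_three])
  have h := eLpNorm_map_measure (μ := volume) (p := 2) (f := fun x => 2 * Real.pi * x) (g := f)
    (by rw [hmap]; exact hf.smul_measure _) (by fun_prop)
  rw [hmap] at h
  refine h.symm.trans_le ?_
  calc _ ≤ eLpNorm f 2 ((1 : ℝ≥0∞) • volume) :=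
        eLpNorm_mono_measure _ (Measure.le_iff.2 fun s _ => by
          simp only [Measure.smul_apply, smul_eq_mul]
          gcongr)
    _ = _ := by rw [one_smul]

/-- Plancherel, as the weight is at least `1`. It makes convergence in the Sobolev norm imply
convergence in `L²`. -/
theorem SobolevStrip.norm_toL2_le (hω : 0 ≤ ω) (F : SobolevStrip v ω) :
    ‖F.toL2‖ ≤ 2 * Real.pi * ‖F‖ := by
  have h2π : (2 * Real.pi) ≠ 0 := by positivity
  have h0 : ‖F.toL2‖ = ‖(𝓕⁻ F.toL2 : Lp ℂ 2 (volume : Measure ℝ))‖ :=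
    ((Lp.fourierTransformₗᵢ ℝ ℂ).symm.norm_map F.toL2).symm
  have h1 : ∀ x, (𝓕⁻ F.toL2 : Lp ℂ 2 (volume : Measure ℝ)) x =
      ((2 * Real.pi : ℝ) : ℂ) • F.inv (2 * Real.pi * x) := fun x => by
    rw [SobolevStrip.inv, invFourier, mul_div_cancel_left₀ _ h2π, smul_eq_mul]
    rw [Complex.ofReal_mul, Complex.ofReal_ofNat,
      mul_inv_cancel_left₀ (by simp [Real.pi_ne_zero])]
  have h2 : eLpNorm (𝓕⁻ F.toL2 : Lp ℂ 2 (volume : Measure ℝ)) 2 ≤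
      ENNReal.ofReal (2 * Real.pi * ‖F‖) := by
    have h3 := eLpNorm_comp_two_pi_mul F.inv (measurable_invFourier _).aestronglyMeasurable
    rw [eLpNorm_congr_ae (ae_of_all volume h1), ENNReal.ofReal_mul (by positivity)]
    refine (eLpNorm_const_smul_le (c := ((2 * Real.pi : ℝ) : ℂ))
      (f := fun x => F.inv (2 * Real.pi * x))).trans ?_
    have h4 : ‖((2 * Real.pi : ℝ) : ℂ)‖ₑ = ENNReal.ofReal (2 * Real.pi) := by
      rw [← ofReal_norm, Complex.norm_real, Real.norm_eq_abs, abs_of_pos (by positivity)]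
    rw [h4]
    exact mul_le_mul_right (h3.trans (F.eLpNorm_inv_le hω)) _
  rw [h0, Lp.norm_def]
  exact ENNReal.toReal_le_of_le_ofReal (by positivity) h2

/-- Division by a weight that is at least `1` stays in `L²`. The Sobolev space is thus isometric to
`L²`, hence complete. -/
theorem SobolevStrip.toWeighted_surjective (hω : 0 ≤ ω) :
    Function.Surjective (SobolevStrip.toWeighted v ω) := by
  intro U
  have h2π : (2 * Real.pi) ≠ 0 := by positivity
  have hwm := (measurable_expWeight v ω).complex_ofReal
  set g : ℝ → ℂ := fun s => (expWeight v ω s : ℂ)⁻¹ * U s with hg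
  have hgm : Measurable g := hwm.inv.mul (Lp.stronglyMeasurable U).measurable
  have hgL : MemLp g 2 := (Lp.memLp U).mono hgm.aestronglyMeasurable (ae_of_all _ fun s => by
    rw [hg, norm_mul, norm_inv, Complex.norm_real, Real.norm_eq_abs,
      abs_of_pos (expWeight_pos v ω s)]
    exact mul_le_of_le_one_left (norm_nonneg _) (inv_le_one_of_one_le₀ (one_le_expWeight v hω s)))
  have hGL : MemLp (fun x => ((2 * Real.pi : ℝ) : ℂ) • g (2 * Real.pi * x)) 2 := by
    have h : MemLp (fun x => g (2 * Real.pi * x)) 2 :=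
      ⟨(hgm.comp (by fun_prop : Measurable fun x : ℝ => 2 * Real.pi * x)).aestronglyMeasurable,
        (eLpNorm_comp_two_pi_mul g hgm.aestronglyMeasurable).trans_lt hgL.2⟩
    exact h.const_smul ((2 * Real.pi : ℝ) : ℂ)
  set F₀ : Lp ℂ 2 (volume : Measure ℝ) := 𝓕 hGL.toLp
  have hF₀ : (𝓕⁻ F₀ : Lp ℂ 2 (volume : Measure ℝ)) = hGL.toLp :=
    FourierTransform.fourierInv_fourier_eq _
  have hinv : invFourier F₀ =ᵐ[volume] g := by
    filter_upwards [ae_dilate hGL.coeFn_toLp] with s hs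
    rw [invFourier, hF₀, hs, mul_div_cancel₀ _ h2π, smul_eq_mul]
    rw [Complex.ofReal_mul, Complex.ofReal_ofNat,
      inv_mul_cancel_left₀ (by simp [Real.pi_ne_zero])]
  have hU : weighted v ω F₀ =ᵐ[volume] U := by
    filter_upwards [hinv] with s hs
    have : (expWeight v ω s : ℂ) ≠ 0 := by exact_mod_cast (expWeight_pos v ω s).ne'
    calc weighted v ω F₀ s = (expWeight v ω s : ℂ) * invFourier F₀ s := rfl
      _ = U s := by rw [hs, hg, mul_inv_cancel_left₀ this]
  have hmem : F₀ ∈ sobolevSubmodule v ω := (memLp_congr_ae hU).2 (Lp.memLp U)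
  refine ⟨(⟨F₀, hmem⟩ : sobolevSubmodule v ω), Lp.ext ?_⟩
  exact (MemLp.coeFn_toLp hmem).trans hU

theorem completeSpace_sobolevStrip (hω : 0 ≤ ω) : CompleteSpace (SobolevStrip v ω) := by
  have hiso : Isometry (SobolevStrip.toWeighted v ω) :=
    AddMonoidHomClass.isometry_of_norm _ fun F => rfl
  exact (hiso.isUniformInducing.completeSpace_congr
    (SobolevStrip.toWeighted_surjective hω)).2 inferInstance

/-- `h` belongs to `W²_v(S_ω)` with norm at most `B`, and the inverse Fourier transform of `h` has
a continuous representative which is bounded by `B` after multiplication with the weight. -/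
def BoundedSobolev (v : AdmissibleWeight) (ω : ℝ) (h : ℂ → ℂ) (B : ℝ) : Prop :=
  ∃ (F : SobolevStrip v ω) (G : ℝ → ℂ), Represents h F ∧ ‖F‖ ≤ B ∧ Continuous G ∧
    F.inv =ᵐ[volume] G ∧ ∀ s, expWeight v ω s * ‖G s‖ ≤ B

/-- Hölder: the inverse weight times the exponential is in `L²` because `|Im z| < ω`. -/
theorem SobolevStrip.integrable_inv_mul_exp (F : SobolevStrip v ω) {z : ℂ} (hz : |z.im| < ω) :
    Integrable fun s : ℝ => F.inv s * Complex.exp (-Complex.I * s * z) := by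
  have hwm := (measurable_expWeight v ω).complex_ofReal
  have h2 : MemLp (fun s : ℝ => (expWeight v ω s : ℂ)⁻¹ * Complex.exp (-Complex.I * s * z)) 2 := by
    refine (memLp_two_exp_neg_abs (sub_pos.2 hz)).mono
      (hwm.inv.mul (by fun_prop)).aestronglyMeasurable (ae_of_all _ fun s => ?_)
    rw [norm_mul, norm_inv, Complex.norm_real, Real.norm_eq_abs, abs_of_pos (expWeight_pos v ω s),
      Real.norm_eq_abs, abs_of_pos (Real.exp_pos _)]
    refine le_trans ?_ (exp_neg_mul_norm_exp_le s z)
    gcongr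
    rw [neg_mul, Real.exp_neg]
    exact inv_anti₀ (Real.exp_pos _) (exp_le_expWeight v ω s)
  refine (F.memLp.integrable_mul h2).congr (ae_of_all _ fun s => ?_)
  have : (expWeight v ω s : ℂ) ≠ 0 := by exact_mod_cast (expWeight_pos v ω s).ne'
  simp only [Pi.mul_apply]
  field_simp

theorem integral_conv_mul_exp {k g : ℝ → ℂ} {z : ℂ}
    (hk : Integrable fun s : ℝ => k s * Complex.exp (-Complex.I * s * z))
    (hg : Integrable fun s : ℝ => g s * Complex.exp (-Complex.I * s * z)) :
    ∫ s : ℝ, (∫ t : ℝ, k (s - t) * g t) * Complex.exp (-Complex.I * s * z) =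
      (∫ s : ℝ, k s * Complex.exp (-Complex.I * s * z)) *
        ∫ s : ℝ, g s * Complex.exp (-Complex.I * s * z) := by
  have h := integral_convolution (ContinuousLinearMap.mul ℂ ℂ) hg hk
  rw [ContinuousLinearMap.mul_apply'] at h
  rw [mul_comm (∫ s : ℝ, k s * _), ← h]
  refine integral_congr_ae (ae_of_all _ fun s => ?_)
  simp only [convolution, ContinuousLinearMap.mul_apply']
  rw [← integral_mul_const]
  refine integral_congr_ae (ae_of_all _ fun t => ?_)
  simp only
  have : Complex.exp (-Complex.I * s * z) = Complex.exp (-Complex.I * t * z) *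
      Complex.exp (-Complex.I * (s - t : ℝ) * z) := by
    rw [← Complex.exp_add]; congr 1; push_cast; ring
  rw [this]; ring

/-- Multiplication of a Sobolev function by a decaying holomorphic function on a larger strip. -/
theorem exists_boundedSobolev_mul (v : AdmissibleWeight) {ω ρ : ℝ} (hω : 0 ≤ ω) (hρ : ω < ρ) :
    ∃ K : ℝ, 0 ≤ K ∧ ∀ (m : ℂ → ℂ) (B b : ℝ), DifferentiableOn ℂ m (strip ρ) →
      (∀ z ∈ strip ρ, ‖m z‖ ≤ B / (1 + (z.re - b) ^ 2)) →
      ∀ (h : ℂ → ℂ) (F : SobolevStrip v ω), Represents h F →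
        BoundedSobolev v ω (m * h) (K * B * ‖F‖) := by
  obtain ⟨a, ha1, ha2⟩ := exists_between hρ
  have ha0 : 0 < a := hω.trans_lt ha1
  obtain ⟨K, hK, hconv⟩ := exists_conv_bound v hω ha1
  refine ⟨K, hK, fun m B b hd hB h F hF => ?_⟩
  have hρ0 : 0 < ρ := hω.trans_lt hρ
  have hB0 : 0 ≤ B := by
    have := (norm_nonneg _).trans (hB b (ofReal_mem_strip hρ0.le b))
    simpa using this
  have hmc : Continuous fun x : ℝ => m x := by
    have := continuous_horizontal (y := 0) hd (by simpa using hρ0)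
    simpa using this
  have hmB : ∀ x : ℝ, ‖m x‖ ≤ B / (1 + (x - b) ^ 2) := fun x => by
    simpa using hB x (ofReal_mem_strip hρ0.le x)
  have hmB' : ∀ x : ℝ, ‖m x‖ ≤ B := fun x => (hmB x).trans (div_le_self hB0 (by
    nlinarith [sq_nonneg (x - b)]))
  have hm1 : Integrable fun x : ℝ => m x :=
    (integrable_decay B b).mono' hmc.aestronglyMeasurable (ae_of_all _ hmB)
  have hm2 : MemLp (fun x : ℝ => m x) 2 := by
    refine (memLp_two_iff_integrable_sq_norm hmc.aestronglyMeasurable).2 ?_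
    refine ((integrable_decay B b).const_mul B).mono'
      (hmc.norm.pow 2).aestronglyMeasurable (ae_of_all _ fun x => ?_)
    rw [Real.norm_eq_abs, abs_of_nonneg (by positivity), sq]
    exact mul_le_mul (hmB' x) (hmB x) (norm_nonneg _) hB0
  have hPL : MemLp (fun x : ℝ => m x * F.toL2 x) 2 :=
    (Lp.memLp F.toL2).of_le_mul (c := B)
      (hmc.aestronglyMeasurable.mul (Lp.aestronglyMeasurable _)) (ae_of_all _ fun x => by
        rw [norm_mul]; gcongr; exact hmB' x)
  set P : Lp ℂ 2 (volume : Measure ℝ) := hPL.toLp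
  have hP : P =ᵐ[volume] fun x => m x * F.toL2 x := hPL.coeFn_toLp
  set k := invIntegral fun x : ℝ => m x
  have hkc : Continuous k := continuous_invIntegral hm1
  have hkB : ∀ s, ‖k s‖ ≤ B * Real.exp (-a * |s|) := norm_invIntegral_le_exp hd hB ha0.le ha2
  set G : ℝ → ℂ := fun s => ∫ t, k (s - t) * F.inv t with hG
  have hinv : invFourier P =ᵐ[volume] G := invFourier_mul_ae_eq hm1 hm2 F.toL2 P hP
  have hGc : Continuous G := continuous_conv ha0 hB0 hkc hkB (F.memLp_inv hω)
  obtain ⟨hsup, hL2⟩ := hconv k F.inv B hB0 hkB (measurable_invFourier _) F.memLp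
  have hwG : weighted v ω P =ᵐ[volume] fun s => (expWeight v ω s : ℂ) * G s := by
    filter_upwards [hinv] with s hs
    rw [← hs]; rfl
  have hwGL : MemLp (fun s => (expWeight v ω s : ℂ) * G s) 2 :=
    ⟨((measurable_expWeight v ω).complex_ofReal.mul hGc.measurable).aestronglyMeasurable,
      hL2.trans_lt (ENNReal.mul_lt_top ENNReal.ofReal_lt_top F.memLp.2)⟩
  have hmem : P ∈ sobolevSubmodule v ω := (memLp_congr_ae hwG).2 hwGL
  set F' : SobolevStrip v ω := (⟨P, hmem⟩ : sobolevSubmodule v ω)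
  have hF'inv : F'.inv =ᵐ[volume] G := hinv
  refine ⟨F', G, ⟨?_, fun hω0 z hz => ?_⟩, ?_, hGc, hF'inv, fun s => ?_⟩
  · refine EventuallyEq.trans ?_ hP.symm
    filter_upwards [hF.1] with x hx
    simp only [Pi.mul_apply, hx]
  · have hz' : |z.im| < ω := (mem_strip_iff hω0).1 hz
    rw [Pi.mul_apply, hF.2 hω0 z hz, eq_integral_kernel hd hB (hz'.trans hρ),
      ← integral_conv_mul_exp (integrable_mul_exp hkc.aestronglyMeasurable hkB (hz'.trans ha1))
        (F.integrable_inv_mul_exp hz')]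
    refine integral_congr_ae ?_
    filter_upwards [hF'inv] with s hs
    rw [hs]
  · rw [F'.norm_eq, F.norm_eq, ← ENNReal.toReal_ofReal (mul_nonneg hK hB0), ← ENNReal.toReal_mul]
    exact ENNReal.toReal_mono (ENNReal.mul_ne_top ENNReal.ofReal_ne_top F.memLp.2.ne)
      ((eLpNorm_congr_ae hwG).trans_le hL2)
  · rw [F.norm_eq]
    exact hsup s

/-! ### Series in the Sobolev space -/

/-- Norm convergence gives almost everywhere convergence along a sequence of finite partial sums,
which must agree with the pointwise sum. -/
theorem ae_eq_of_hasSum_Lp {ι : Type*} [Countable ι] {f : ι → Lp ℂ 2 (volume : Measure ℝ)}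
    {L : Lp ℂ 2 (volume : Measure ℝ)} (hf : HasSum f L) {g : ι → ℝ → ℂ} {l : ℝ → ℂ}
    (hfg : ∀ i, f i =ᵐ[volume] g i) (hg : ∀ᵐ x, HasSum (fun i => g i x) (l x)) :
    L =ᵐ[volume] l := by
  have h1 : TendstoInMeasure volume (fun s : Finset ι => ((∑ i ∈ s, f i :
      Lp ℂ 2 (volume : Measure ℝ)) : ℝ → ℂ)) atTop L :=
    tendstoInMeasure_of_tendsto_Lp hf
  obtain ⟨ns, hns, hae⟩ := h1.exists_seq_tendsto_ae'
  have h2 : ∀ᵐ x, ∀ s : Finset ι, (∑ i ∈ s, f i : Lp ℂ 2 (volume : Measure ℝ)) x =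
      ∑ i ∈ s, g i x := by
    rw [ae_all_iff]
    intro s
    filter_upwards [Lp.coeFn_finsetSum s f, ae_all_iff.2 hfg] with x hx hx'
    rw [hx, Finset.sum_apply]
    exact Finset.sum_congr rfl fun i _ => hx' i
  filter_upwards [hae, h2, hg] with x hx hx' hx''
  simp only [hx'] at hx
  exact tendsto_nhds_unique hx (hx''.comp hns)

/-- The series converges in the Sobolev norm, uniformly for the continuous representatives, and
pointwise on the strip. The continuous maps `T` and `W` into `L²` identify the three limits. -/
theorem BoundedSobolev.of_hasSum {ι : Type*} [Countable ι] (hω : 0 ≤ ω) {h : ι → ℂ → ℂ}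
    {H : ℂ → ℂ} {B : ι → ℝ} (hh : ∀ i, BoundedSobolev v ω (h i) (B i)) (hB : Summable B)
    (hH : ∀ z ∈ strip ω, HasSum (fun i => h i z) (H z)) :
    BoundedSobolev v ω H (∑' i, B i) := by
  have := completeSpace_sobolevStrip (v := v) hω
  choose F G hF hFB hGc hFG hGB using hh
  have hGn : ∀ i s, ‖G i s‖ ≤ B i := fun i s =>
    (le_mul_of_one_le_left (norm_nonneg _) (one_le_expWeight v hω s)).trans (hGB i s)
  have hFs : Summable F := Summable.of_norm_bounded hB hFB
  have hGs : ∀ s, Summable fun i => G i s := fun s => Summable.of_norm_bounded hB (hGn · s)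
  set FF := ∑' i, F i
  set GG : ℝ → ℂ := fun s => ∑' i, G i s
  let T : SobolevStrip v ω →L[ℂ] Lp ℂ 2 (volume : Measure ℝ) :=
    LinearMap.mkContinuous
      { toFun := SobolevStrip.toL2, map_add' := fun _ _ => rfl, map_smul' := fun _ _ => rfl }
      (2 * Real.pi) (SobolevStrip.norm_toL2_le hω)
  let W : SobolevStrip v ω →L[ℂ] Lp ℂ 2 (volume : Measure ℝ) :=
    LinearMap.mkContinuous (SobolevStrip.toWeighted v ω) 1 (fun F => by rw [one_mul]; exact le_rfl)
  have hT : FF.toL2 =ᵐ[volume] fun x : ℝ => H x :=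
    ae_eq_of_hasSum_Lp (hFs.hasSum.mapL T) (fun i => (hF i).1.symm)
      (ae_of_all _ fun x => hH x (ofReal_mem_strip hω x))
  have hW : SobolevStrip.toWeighted v ω FF =ᵐ[volume] fun s => (expWeight v ω s : ℂ) * GG s := by
    refine ae_eq_of_hasSum_Lp (hFs.hasSum.mapL W)
      (g := fun i s => (expWeight v ω s : ℂ) * G i s) (fun i => ?_)
      (ae_of_all _ fun s => (hGs s).hasSum.mul_left _)
    filter_upwards [(F i).coeFn_toWeighted, hFG i] with s hs hs'
    rw [← hs']; exact hs
  have hinv : FF.inv =ᵐ[volume] GG := by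
    filter_upwards [FF.coeFn_toWeighted, hW] with s hs hs'
    have : (expWeight v ω s : ℂ) ≠ 0 := by exact_mod_cast (expWeight_pos v ω s).ne'
    exact mul_left_cancel₀ this (hs.symm.trans hs')
  refine ⟨FF, GG, ⟨hT.symm, fun hω0 z hz => ?_⟩, tsum_of_norm_bounded hB.hasSum hFB,
    continuous_tsum hGc hB hGn, hinv, fun s => ?_⟩
  · have hz' : |z.im| < ω := (mem_strip_iff hω0).1 hz
    have hGexp : ∀ i s, ‖G i s‖ ≤ B i * Real.exp (-ω * |s|) := fun i s => by
      rw [neg_mul, Real.exp_neg, ← div_eq_mul_inv, le_div_iff₀ (Real.exp_pos _), mul_comm]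
      exact (mul_le_mul_of_nonneg_right (exp_le_expWeight v ω s) (norm_nonneg _)).trans (hGB i s)
    have hint : ∀ i, Integrable fun s : ℝ => G i s * Complex.exp (-Complex.I * s * z) := fun i =>
      integrable_mul_exp (hGc i).aestronglyMeasurable (hGexp i) hz'
    have hB0 : ∀ i, 0 ≤ B i := fun i => (norm_nonneg _).trans (hFB i)
    -- Sum and integral may be exchanged since `ω - |Im z| > 0` leaves an integrable exponential.
    have hsum := hasSum_integral_of_summable_integral_norm hint (by
      refine Summable.of_nonneg_of_le (fun i => by positivity) (fun i => ?_)
        (hB.mul_right (∫ s : ℝ, Real.exp (-(ω - |z.im|) * |s|)))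
      rw [← integral_const_mul]
      refine integral_mono (hint i).norm
        ((integrable_exp_neg_abs (sub_pos.2 hz')).const_mul _) fun s => ?_
      simp only [norm_mul]
      calc _ ≤ B i * Real.exp (-ω * |s|) * ‖Complex.exp (-Complex.I * s * z)‖ := by
            gcongr; exact hGexp i s
        _ = B i * (Real.exp (-ω * |s|) * ‖Complex.exp (-Complex.I * s * z)‖) := by ring
        _ ≤ _ := mul_le_mul_of_nonneg_left (exp_neg_mul_norm_exp_le s z) (hB0 i))
    have hh : ∀ i, h i z = ∫ s : ℝ, G i s * Complex.exp (-Complex.I * s * z) := fun i => by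
      rw [(hF i).2 hω0 z hz]
      refine integral_congr_ae ?_
      filter_upwards [hFG i] with s hs
      rw [hs]
    simp only [← hh] at hsum
    rw [(hH z hz).unique hsum]
    refine integral_congr_ae ?_
    filter_upwards [hinv] with s hs
    rw [hs, tsum_mul_right]
  · rw [← norm_expWeight_mul, ← tsum_mul_left]
    refine tsum_of_norm_bounded hB.hasSum fun i => ?_
    rw [norm_expWeight_mul]
    exact hGB i s

/-! ### Multipliers of Hörmander functions -/

theorem BoundedSobolev.mono {h : ℂ → ℂ} {B B' : ℝ} (hh : BoundedSobolev v ω h B) (hB : B ≤ B') :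
    BoundedSobolev v ω h B' := by
  obtain ⟨F, G, h1, h2, h3, h4, h5⟩ := hh
  exact ⟨F, G, h1, h2.trans hB, h3, h4, fun s => (h5 s).trans hB⟩

theorem BoundedSobolev.memSobolev {h : ℂ → ℂ} {B : ℝ} (hh : BoundedSobolev v ω h B) :
    MemSobolev v ω h := by
  obtain ⟨F, G, h1, -⟩ := hh
  exact ⟨F, h1⟩

theorem toSobolev_eq {h : ℂ → ℂ} {F : SobolevStrip v ω} (hF : Represents h F) :
    toSobolev v ω h = F :=
  (represents_toSobolev ⟨F, hF⟩).unique hF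

theorem BoundedSobolev.norm_le {h : ℂ → ℂ} {B : ℝ} (hh : BoundedSobolev v ω h B) :
    ‖toSobolev v ω h‖ ≤ B := by
  obtain ⟨F, G, h1, h2, -⟩ := hh
  rwa [toSobolev_eq h1]

theorem SobolevStrip.inv_add_smul (F G : SobolevStrip v ω) (c : ℂ) :
    (F + c • G).inv =ᵐ[volume] fun s => F.inv s + c * G.inv s := by
  have h1 := Lp.coeFn_add (𝓕⁻ F.toL2 : Lp ℂ 2 (volume : Measure ℝ)) (𝓕⁻ (c • G.toL2))
  have h2 := Lp.coeFn_smul c (𝓕⁻ G.toL2 : Lp ℂ 2 (volume : Measure ℝ))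
  filter_upwards [ae_dilate h1, ae_dilate h2] with s hs hs'
  have e : (F + c • G).inv s = invFourier (F.toL2 + c • G.toL2) s := rfl
  rw [e]
  simp only [SobolevStrip.inv, invFourier, Pi.add_apply, Pi.smul_apply, smul_eq_mul,
    FourierTransform.fourierInv_add, FourierTransform.fourierInv_smul] at hs hs' ⊢
  rw [hs, hs']; ring

theorem Represents.add_smul {h₁ h₂ : ℂ → ℂ} {F G : SobolevStrip v ω} (hF : Represents h₁ F)
    (hG : Represents h₂ G) (c : ℂ) : Represents (h₁ + c • h₂) (F + c • G) := by
  refine ⟨?_, fun hω z hz => ?_⟩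
  · have h1 := Lp.coeFn_add F.toL2 (c • G.toL2)
    have h2 := Lp.coeFn_smul c G.toL2
    have e : (F + c • G).toL2 = F.toL2 + c • G.toL2 := rfl
    rw [e]
    filter_upwards [h1, h2, hF.1, hG.1] with x hx1 hx2 hx3 hx4
    have e2 : (h₁ + c • h₂) x = h₁ x + c * h₂ x := rfl
    rw [hx1, Pi.add_apply (F.toL2 : ℝ → ℂ), hx2, Pi.smul_apply, e2, hx3, hx4, smul_eq_mul]
  · have hz' := (mem_strip_iff hω).1 hz
    have h1 : (h₁ + c • h₂) z = h₁ z + c * h₂ z := rfl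
    rw [h1, hF.2 hω z hz, hG.2 hω z hz, ← integral_const_mul,
      ← integral_add (F.integrable_inv_mul_exp hz') ((G.integrable_inv_mul_exp hz').const_mul c)]
    refine integral_congr_ae ?_
    filter_upwards [F.inv_add_smul G c] with s hs
    rw [hs]; ring

/-- By `(c - b)² ≤ 2(x - b)² + 2(x - c)²`, one power of decay about `c` is traded for decay in `c -
b`. The remaining power keeps the product an admissible multiplier centred at `c`. -/
theorem decay_mul_decay_le {A C x b c : ℝ} (hA : 0 ≤ A) (hC : 0 ≤ C) :
    A / (1 + (x - b) ^ 2) * (C / (1 + (x - c) ^ 2) ^ 2) ≤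
      2 * A * C / (1 + (c - b) ^ 2) / (1 + (x - c) ^ 2) := by
  have h : 1 + (c - b) ^ 2 ≤ 2 * ((1 + (x - b) ^ 2) * (1 + (x - c) ^ 2)) := by
    nlinarith [sq_nonneg ((x - b) + (x - c)), sq_nonneg (x - b), sq_nonneg (x - c),
      mul_nonneg (sq_nonneg (x - b)) (sq_nonneg (x - c))]
  rw [div_mul_div_comm, div_div, div_le_div_iff₀ (by positivity) (by positivity)]
  calc A * C * ((1 + (c - b) ^ 2) * (1 + (x - c) ^ 2))
      ≤ A * C * (2 * ((1 + (x - b) ^ 2) * (1 + (x - c) ^ 2)) * (1 + (x - c) ^ 2)) := by gcongr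
    _ = _ := by ring

theorem norm_le_hormanderNorm {ψ f : ℂ → ℂ} (hf : MemHormander v ω ψ f) (t : ℝ) :
    ‖toSobolev v ω (translate (t : ℂ) ψ * f)‖ ≤ hormanderNorm v ω ψ f :=
  le_ciSup hf.2 t

theorem hormanderNorm_nonneg (ψ f : ℂ → ℂ) : 0 ≤ hormanderNorm v ω ψ f :=
  Real.iSup_nonneg fun _ => norm_nonneg _

/-- Decaying holomorphic functions on a larger strip multiply the Hörmander space into the
Sobolev space. -/
theorem exists_boundedSobolev_mul_hormander (v : AdmissibleWeight) {ω ρ : ℝ} (hω : 0 ≤ ω)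
    (hρ : ω < ρ) {ψ : ℂ → ℂ} (hψ : ψ ∈ HolSchwartzClosed ω) (hψ0 : ∃ z ∈ strip ω, ψ z ≠ 0) :
    ∃ K : ℝ, 0 ≤ K ∧ ∀ (χ : ℂ → ℂ) (A b : ℝ), DifferentiableOn ℂ χ (strip ρ) →
      (∀ z ∈ strip ρ, ‖χ z‖ ≤ A / (1 + (z.re - b) ^ 2)) →
      ∀ f, MemHormander v ω ψ f → BoundedSobolev v ω (χ * f) (K * A * hormanderNorm v ω ψ f) := by
  obtain ⟨σ, hσ, hψσ⟩ := hψ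
  obtain ⟨ρ', h1, h2⟩ := exists_between (lt_min hρ hσ)
  have hρ' : 0 < ρ' := hω.trans_lt h1
  have hρ'ρ : ρ' < ρ := h2.trans_le (min_le_left _ _)
  obtain ⟨ε, hε, hε1, η, C, hC, hηd, hηB, hsum⟩ :=
    exists_partition hω hσ hρ' (h2.trans_le (min_le_right _ _)) hψσ hψ0
  obtain ⟨K, hK, hmul⟩ := exists_boundedSobolev_mul v hω h1
  refine ⟨K * (4 * (2 * C) * Real.pi / ε), by positivity, fun χ A b hd hB f hf => ?_⟩
  have hA : 0 ≤ A := by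
    have := (norm_nonneg _).trans (hB b (ofReal_mem_strip (hρ'.trans hρ'ρ).le b))
    simpa using this
  set N := hormanderNorm v ω ψ f
  have hN : 0 ≤ N := hormanderNorm_nonneg ψ f
  -- The multiplier `χ τ_{εn}η` is centred at `εn` and acts on `τ_{εn}ψ f`, whose norm is at most
  -- `N`.
  have hterm : ∀ n : ℤ, BoundedSobolev v ω
      ((χ * translate ((ε * n : ℝ) : ℂ) η) * (translate ((ε * n : ℝ) : ℂ) ψ * f))
      (2 * A * C / (1 + (ε * n - b) ^ 2) * (K * N)) := fun n => by
    refine (hmul _ (2 * A * C / (1 + (ε * n - b) ^ 2)) (ε * n)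
      ((hd.mono (strip_subset_strip hρ'.le hρ'ρ)).mul
        (hηd.comp (by fun_prop) fun z hz => sub_ofReal_mem_strip hρ' hz _)) (fun z hz => ?_) _ _
      (represents_toSobolev (hf.1 (ε * n)))).mono ?_
    · have hη := hηB _ (sub_ofReal_mem_strip hρ' hz (ε * n))
      rw [Complex.sub_re, Complex.ofReal_re] at hη
      refine le_trans ?_ (decay_mul_decay_le hA hC)
      rw [Pi.mul_apply, norm_mul]
      exact mul_le_mul (hB z (strip_subset_strip hρ'.le hρ'ρ hz)) hη (norm_nonneg _)
        (by positivity)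
    · have h3 := norm_le_hormanderNorm hf (ε * n)
      calc _ ≤ K * (2 * A * C / (1 + (ε * n - b) ^ 2)) * N := by gcongr
        _ = _ := by ring
  have hs := summable_decay_int b (by positivity : 0 ≤ 2 * A * C) hε hε1
  refine (BoundedSobolev.of_hasSum hω hterm (hs.1.mul_right _) (H := χ * f) fun z hz => ?_).mono ?_
  · have h3 := (hsum z (strip_subset_strip hω h1 hz)).mul_left (χ z * f z)
    rw [mul_one] at h3
    refine h3.congr_fun fun n => ?_
    simp only [Pi.mul_apply, translate_apply]
    ring
  · rw [tsum_mul_right]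
    calc _ ≤ 4 * (2 * A * C) * Real.pi / ε * (K * N) := by gcongr; exact hs.2
      _ = _ := by ring

/-! ### Translates, holomorphy and change of the localizing function -/

theorem translate_mem_strip {ρ σ : ℝ} (hρ : 0 < ρ) {w : ℂ} (hw : ρ + |w.im| ≤ σ) {z : ℂ}
    (hz : z ∈ strip ρ) : z - w ∈ strip σ := by
  have hσ : 0 < σ := by linarith [abs_nonneg w.im]
  rw [mem_strip_iff hρ] at hz
  rw [mem_strip_iff hσ, Complex.sub_im]
  have := abs_sub z.im w.im
  linarith

/-- For `z ∈ S_θ` the translate is holomorphic on the strip of height `σ - θ > ω` and decays about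
`Re z` with the constant of `φ`. -/
theorem exists_boundedSobolev_translate (v : AdmissibleWeight) {ω θ σ : ℝ} (hω : 0 ≤ ω)
    (hθ : 0 < θ) (hσ : θ + ω < σ) {ψ φ : ℂ → ℂ} (hψ : ψ ∈ HolSchwartzClosed ω)
    (hψ0 : ∃ z ∈ strip ω, ψ z ≠ 0) (hφ : φ ∈ HolSchwartz σ) :
    ∃ C : ℝ, 0 ≤ C ∧ ∀ f, MemHormander v ω ψ f → ∀ z ∈ strip θ,
      BoundedSobolev v ω (translate z φ * f) (C * hormanderNorm v ω ψ f) := by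
  have hσ0 : 0 < σ := by linarith
  obtain ⟨A, hA, hφA⟩ := exists_decay_of_holSchwartz hσ0 hφ one_pos
  obtain ⟨K, hK, hb⟩ := exists_boundedSobolev_mul_hormander v hω (by linarith : ω < σ - θ) hψ hψ0
  refine ⟨K * A, by positivity, fun f hf z hz => ?_⟩
  have hz' := (mem_strip_iff hθ).1 hz
  have hsub : ∀ w ∈ strip (σ - θ), w - z ∈ strip σ := fun w hw =>
    translate_mem_strip (by linarith) (by linarith) hw
  refine hb _ A z.re (hφ.1.comp (by fun_prop) hsub) (fun w hw => ?_) f hf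
  simpa using hφA _ (hsub w hw)

/-- The multiplier estimate applied to the first order Taylor remainder of `w ↦ τ_w φ` bounds the
remainder in the Sobolev norm by `O(‖w - z‖²)`. Differentiating `φ(x - w)` in `w` produces the minus
sign. -/
theorem hasDerivAt_toSobolev_translate (v : AdmissibleWeight) {ω θ : ℝ} (hω : 0 ≤ ω)
    (hθ : 0 < θ) {ψ φ f : ℂ → ℂ} (hψ : ψ ∈ HolSchwartzClosed ω)
    (hψ0 : ∃ z ∈ strip ω, ψ z ≠ 0) (hφ : φ ∈ HolSchwartz (θ + ω)) (hf : MemHormander v ω ψ f)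
    {z : ℂ} (hz : z ∈ strip θ) :
    HasDerivAt (fun w => toSobolev v ω (translate w φ * f))
      (toSobolev v ω (-translate z (deriv φ) * f)) z := by
  rw [mem_strip_iff hθ] at hz
  -- For `‖w - z‖ < d` and `x ∈ S_{ω+d}`, the height of `x - w` is below `(ω + d) + (θ - 4d) + d = θ
  -- + ω - 2d`, which leaves room for Cauchy's estimates.
  set d := (θ - |z.im|) / 4 with hd
  have hd0 : 0 < d := by simp only [hd]; linarith
  have hdz : |z.im| = θ - 4 * d := by simp only [hd]; ring
  have hσ0 : 0 < θ + ω := by linarith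
  have hσ' : 0 < θ + ω - 2 * d := by linarith [abs_nonneg z.im]
  have hσ : θ + ω - 2 * d < θ + ω := by linarith
  obtain ⟨A, hA, hφA⟩ := exists_decay_of_holSchwartz hσ0 hφ one_pos
  have hφA' : ∀ w ∈ strip (θ + ω), ‖φ w‖ ≤ A / (1 + (w.re - 0) ^ 2) := fun w hw => by
    simpa using hφA w hw
  obtain ⟨C, hC, htaylor⟩ := norm_taylor_le_decay hσ' hσ hA hφ.1 hφA'
  obtain ⟨K, hK, hb⟩ := exists_boundedSobolev_mul_hormander v hω (by linarith : ω < ω + d) hψ hψ0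
  have hρ : 0 < ω + d := by linarith
  have hball : ∀ w, ‖w - z‖ < d → ∀ x ∈ strip (ω + d), x - w ∈ strip (θ + ω - 2 * d) := by
    intro w hw x hx
    refine translate_mem_strip hρ ?_ hx
    have h1 := (Complex.abs_im_le_norm (w - z)).trans_lt hw
    rw [Complex.sub_im] at h1
    have := abs_sub_abs_le_abs_sub w.im z.im
    linarith
  have hz0 : ‖z - z‖ < d := by simpa using hd0
  have hsub := strip_subset_strip hσ'.le hσ
  have hdiffz : ∀ w, ‖w - z‖ < d → DifferentiableOn ℂ (translate w φ) (strip (ω + d)) :=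
    fun w hw => hφ.1.comp (by fun_prop) fun x hx => hsub (hball w hw x hx)
  have hderivd : DifferentiableOn ℂ (translate z (deriv φ)) (strip (ω + d)) :=
    (hφ.1.deriv (isOpen_strip hσ0)).comp (by fun_prop) fun x hx => hsub (hball z hz0 x hx)
  have hmemφ : ∀ w, ‖w - z‖ < d → MemSobolev v ω (translate w φ * f) := fun w hw =>
    (hb _ A w.re (hdiffz w hw) (fun x hx => by
      simpa using hφA _ (hsub (hball w hw x hx))) f hf).memSobolev
  have hmemD : MemSobolev v ω (-translate z (deriv φ) * f) :=
    (hb _ _ z.re hderivd.neg (fun x hx => by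
      simpa using norm_deriv_le_decay hσ' hσ hA hφ.1 hφA' (hball z hz0 x hx)) f hf).memSobolev
  have hbound : ∀ w, ‖w - z‖ < min d 1 → ‖toSobolev v ω (translate w φ * f) -
      toSobolev v ω (translate z φ * f) - (w - z) • toSobolev v ω (-translate z (deriv φ) * f)‖ ≤
        K * C * hormanderNorm v ω ψ f * ‖w - z‖ ^ 2 := by
    intro w hw
    have hwd : ‖w - z‖ < d := hw.trans_le (min_le_left _ _)
    have hw1 : ‖w - z‖ ≤ 1 := hw.le.trans (min_le_right _ _)
    have hrep := ((represents_toSobolev (hmemφ w hwd)).add_smul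
      (represents_toSobolev (hmemφ z hz0)) (-1)).add_smul (represents_toSobolev hmemD) (-(w - z))
    have hχ : translate w φ * f + (-1 : ℂ) • (translate z φ * f) +
        (-(w - z)) • (-translate z (deriv φ) * f) =
        (translate w φ - translate z φ + (w - z) • translate z (deriv φ)) * f := by
      ext x
      simp only [Pi.add_apply, Pi.mul_apply, Pi.smul_apply, Pi.neg_apply, Pi.sub_apply, smul_eq_mul]
      ring
    rw [hχ] at hrep
    have hB := hb (translate w φ - translate z φ + (w - z) • translate z (deriv φ))
      (C * ‖w - z‖ ^ 2) z.re
      (((hdiffz w hwd).sub (hdiffz z hz0)).add (hderivd.const_smul _)) (fun x hx => by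
        have e : x - w - (x - z) = z - w := by ring
        have := htaylor (x - z) (hball z hz0 x hx) (x - w) (hball w hwd x hx)
          (by rwa [e, norm_sub_rev])
        rw [e, norm_sub_rev z w, Complex.sub_re, sub_zero] at this
        refine (le_of_eq ?_).trans this
        congr 1
        simp only [Pi.add_apply, Pi.sub_apply, Pi.smul_apply, translate_apply, smul_eq_mul]
        ring) f hf
    have hle := hB.norm_le
    rw [toSobolev_eq hrep] at hle
    calc _ = _ := by
          congr 1
          rw [neg_smul, neg_smul, one_smul, sub_eq_add_neg, sub_eq_add_neg]
      _ ≤ _ := hle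
      _ = _ := by ring
  rw [hasDerivAt_iff_isLittleO]
  have hO : (fun w => toSobolev v ω (translate w φ * f) - toSobolev v ω (translate z φ * f) -
      (w - z) • toSobolev v ω (-translate z (deriv φ) * f)) =O[𝓝 z] fun w => ‖w - z‖ ^ 2 := by
    refine Asymptotics.IsBigO.of_bound (K * C * hormanderNorm v ω ψ f) ?_
    filter_upwards [Metric.ball_mem_nhds z (lt_min hd0 one_pos)] with w hw
    rw [norm_pow, norm_norm]
    exact hbound w (by rw [← dist_eq_norm]; exact hw)
  refine hO.trans_isLittleO ?_
  have h1 : (fun w : ℂ => ‖w - z‖ ^ 2) =o[𝓝 z] fun w => ‖w - z‖ ^ 1 :=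
    (Asymptotics.isLittleO_pow_pow (𝕜 := ℝ) one_lt_two).comp_tendsto (by
      have : Continuous fun w : ℂ => ‖w - z‖ := by fun_prop
      simpa using this.tendsto z)
  simpa using h1

theorem exists_hormanderNorm_le (v : AdmissibleWeight) {ω : ℝ} (hω : 0 ≤ ω) {ψ ψ' : ℂ → ℂ}
    (hψ : ψ ∈ HolSchwartzClosed ω) (hψ0 : ∃ z ∈ strip ω, ψ z ≠ 0)
    (hψ' : ψ' ∈ HolSchwartzClosed ω) :
    ∃ C : ℝ, 0 ≤ C ∧ ∀ f, MemHormander v ω ψ f →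
      MemHormander v ω ψ' f ∧ hormanderNorm v ω ψ' f ≤ C * hormanderNorm v ω ψ f := by
  obtain ⟨σ, hσ, hψσ⟩ := hψ'
  -- Any positive height below `σ - ω` would do, as only real translates of `ψ'` are needed.
  obtain ⟨C, hC, hb⟩ := exists_boundedSobolev_translate v hω (by linarith : 0 < (σ - ω) / 2)
    (by linarith : (σ - ω) / 2 + ω < σ) hψ hψ0 hψσ
  have hb' : ∀ f, MemHormander v ω ψ f → ∀ t : ℝ,
      BoundedSobolev v ω (translate (t : ℂ) ψ' * f) (C * hormanderNorm v ω ψ f) :=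
    fun f hf t => hb f hf t (ofReal_mem_strip (by linarith) t)
  refine ⟨C, hC, fun f hf => ⟨⟨fun t => (hb' f hf t).memSobolev, ?_⟩, ?_⟩⟩
  · refine ⟨C * hormanderNorm v ω ψ f, ?_⟩
    rintro _ ⟨t, rfl⟩
    exact (hb' f hf t).norm_le
  · exact ciSup_le fun t => (hb' f hf t).norm_le

end StripHormander

theorem mainTheorem6 (v : AdmissibleWeight) (ω θ : ℝ) (hω : 0 ≤ ω) (hθ : 0 < θ)
    (ψ φ : ℂ → ℂ) (hψ : ψ ∈ HolSchwartzClosed ω) (hψ0 : ∃ z ∈ strip ω, ψ z ≠ 0)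
    (hφ : φ ∈ HolSchwartz (θ + ω)) :
    -- holomorphy of `z ↦ τ_z φ · f` on `S_θ` with values in the Sobolev space
    (∀ f, MemHormander v ω ψ f →
      (∀ z ∈ strip θ, MemSobolev v ω (translate z φ * f)) ∧
      DifferentiableOn ℂ (fun z => toSobolev v ω (translate z φ * f)) (strip θ)) ∧
    -- uniform norm bound (the condition on `θ'` is automatic for `θ' < θ`)
    (∀ θ', 0 < θ' → θ' ≤ θ → φ ∈ HolSchwartzClosed (θ' + ω) →
      ∃ C : ℝ, ∀ f, MemHormander v ω ψ f → ∀ z ∈ strip θ',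
        ‖toSobolev v ω (translate z φ * f)‖ ≤ C * hormanderNorm v ω ψ f) ∧
    -- continuity of the inverse Fourier transforms, and their uniform weighted bound
    (∃ h : (ℂ → ℂ) → ℂ → ℝ → ℂ,
      (∀ f, MemHormander v ω ψ f → ∀ z ∈ strip θ, Continuous (h f z) ∧
        (toSobolev v ω (translate z φ * f)).inv =ᵐ[volume] h f z) ∧
      (∀ θ', 0 < θ' → θ' ≤ θ → φ ∈ HolSchwartzClosed (θ' + ω) →
        ∃ C : ℝ, ∀ f, MemHormander v ω ψ f → ∀ z ∈ strip θ', ∀ s : ℝ,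
          v s * Real.exp (ω * |s|) * ‖h f z s‖ ≤ C * hormanderNorm v ω ψ f)) ∧
    -- representation formula
    (0 < ω → ∀ f, MemHormander v ω ψ f → ∀ z ∈ strip θ ∩ strip ω,
      Integrable (fun s : ℝ => (toSobolev v ω (translate z φ * f)).inv s *
        Complex.exp (-Complex.I * s * z)) ∧
      φ 0 * f z = ∫ s : ℝ, (toSobolev v ω (translate z φ * f)).inv s *
        Complex.exp (-Complex.I * s * z)) ∧
    -- independence of the localizing function, with equivalent norms
    (∀ ψ' ∈ HolSchwartzClosed ω, (∃ z ∈ strip ω, ψ' z ≠ 0) →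
      (∀ f, MemHormander v ω ψ f ↔ MemHormander v ω ψ' f) ∧
      ∃ C : ℝ, ∀ f, MemHormander v ω ψ f →
        hormanderNorm v ω ψ' f ≤ C * hormanderNorm v ω ψ f ∧
        hormanderNorm v ω ψ f ≤ C * hormanderNorm v ω ψ' f) := by
  have hmem : ∀ f, MemHormander v ω ψ f → ∀ z ∈ strip θ,
      ∃ B, BoundedSobolev v ω (translate z φ * f) B := fun f hf z hz => by
    obtain ⟨θ', h1, h2⟩ := exists_between ((mem_strip_iff hθ).1 hz)
    have h0 : 0 < θ' := (abs_nonneg _).trans_lt h1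
    obtain ⟨C, -, hC⟩ := exists_boundedSobolev_translate v hω h0
      (by linarith : θ' + ω < θ + ω) hψ hψ0 hφ
    exact ⟨_, hC f hf z ((mem_strip_iff h0).2 h1)⟩
  have huni : ∀ θ', 0 < θ' → φ ∈ HolSchwartzClosed (θ' + ω) →
      ∃ C : ℝ, ∀ f, MemHormander v ω ψ f → ∀ z ∈ strip θ',
        BoundedSobolev v ω (translate z φ * f) (C * hormanderNorm v ω ψ f) := by
    rintro θ' h0 ⟨σ, hσ, hφσ⟩
    obtain ⟨C, -, hC⟩ := exists_boundedSobolev_translate v hω h0 hσ hψ hψ0 hφσ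
    exact ⟨C, hC⟩
  refine ⟨fun f hf => ⟨fun z hz => ?_, fun z hz => ?_⟩, fun θ' h0 _ hφ' => ?_, ?_,
    fun hω0 f hf z hz => ?_, fun ψ' hψ' hψ0' => ?_⟩
  · obtain ⟨B, hB⟩ := hmem f hf z hz
    exact hB.memSobolev
  · exact (hasDerivAt_toSobolev_translate v hω hθ hψ hψ0 hφ hf
      hz).differentiableAt.differentiableWithinAt
  · obtain ⟨C, hC⟩ := huni θ' h0 hφ'
    exact ⟨C, fun f hf z hz => (hC f hf z hz).norm_le⟩
  · classical
    have hex : ∀ f, MemHormander v ω ψ f → ∀ z ∈ strip θ, ∃ G : ℝ → ℂ, Continuous G ∧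
        (toSobolev v ω (translate z φ * f)).inv =ᵐ[volume] G := fun f hf z hz => by
      obtain ⟨B, F, G, h1, -, h3, h4, -⟩ := hmem f hf z hz
      exact ⟨G, h3, by rwa [toSobolev_eq h1]⟩
    -- The representative is chosen without reference to `θ'`. Continuous representatives are
    -- unique, so each choice of `θ'` bounds the same function.
    refine ⟨fun f z => if h : ∃ G : ℝ → ℂ, Continuous G ∧
      (toSobolev v ω (translate z φ * f)).inv =ᵐ[volume] G then h.choose else 0,
      fun f hf z hz => ?_, fun θ' h0 hθ' hφ' => ?_⟩
    · beta_reduce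
      rw [dif_pos (hex f hf z hz)]
      exact (hex f hf z hz).choose_spec
    · obtain ⟨C, hC⟩ := huni θ' h0 hφ'
      refine ⟨C, fun f hf z hz s => ?_⟩
      obtain ⟨F, G, h1, -, h3, h4, h5⟩ := hC f hf z hz
      have hx : ∃ G : ℝ → ℂ, Continuous G ∧
        (toSobolev v ω (translate z φ * f)).inv =ᵐ[volume] G := ⟨G, h3, by rwa [toSobolev_eq h1]⟩
      beta_reduce
      rw [dif_pos hx]
      have hspec := hx.choose_spec
      have e : hx.choose = G := by
        refine (hspec.1.ae_eq_iff_eq volume h3).1 (hspec.2.symm.trans ?_)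
        rwa [toSobolev_eq h1]
      rw [e]
      exact h5 s
  · obtain ⟨B, hB⟩ := hmem f hf z hz.1
    refine ⟨SobolevStrip.integrable_inv_mul_exp _ ((mem_strip_iff hω0).1 hz.2), ?_⟩
    -- Evaluated at the translation point itself, the localizing factor is `φ (z - z) = φ 0`.
    have h := (represents_toSobolev hB.memSobolev).2 hω0 z hz.2
    rwa [Pi.mul_apply, translate_apply, sub_self] at h
  · obtain ⟨C₁, hC₁, h1⟩ := exists_hormanderNorm_le v hω hψ hψ0 hψ'
    obtain ⟨C₂, hC₂, h2⟩ := exists_hormanderNorm_le v hω hψ' hψ0' hψ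
    refine ⟨fun f => ⟨fun hf => (h1 f hf).1, fun hf => (h2 f hf).1⟩, max C₁ C₂, fun f hf => ⟨?_, ?_⟩⟩
    · exact (h1 f hf).2.trans
        (mul_le_mul_of_nonneg_right (le_max_left _ _) (hormanderNorm_nonneg _ _))
    · exact (h2 f (h1 f hf).1).2.trans
        (mul_le_mul_of_nonneg_right (le_max_right _ _) (hormanderNorm_nonneg _ _))
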